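/- **Setting.** Let $(E,\mathcal F,\mu)$ be a probability space with $L^2(E,\mu)$ separable, carrying a full Markov triple (identities between random variables hold $\mu$-a.s.): a unital algebra $\mathcal A$ of real measurable functions stable under $\mathcal C^\infty$ functions $\Psi:\mathbb R^k\to\mathbb R$; an ideal $\mathcal A_0\subseteq\mathcal A$ of bounded functions, dense in $L^p(\mu)$ for all $p\in[1,\infty)$ and stable under $\mathcal C^\infty$ functions vanishing at $0$; a linear operator $L:\mathcal A\to\mathcal A$ with $L\mathcal A_0\subseteq\mathcal A_0$ and $\Gamma(F,G)=\frac12(L(FG)-F\,LG-G\,LF)$ mapping $\mathcal A_0\times\mathcal A_0$ to $\mathcal A_0$, with $\Gamma(F,F)\ge0$ and $\Gamma(F,F)=0$ iff $F$ is constant; for each $F\in\mathcal A_0$ a constant $c_F$ with $|\int\Gamma(F,G)\,d\mu|\le c_F\|G\|_2$ for all $G\in\mathcal A_0$; integration by parts $\int G\,LF\,d\mu=-\int\Gamma(F,G)\,d\mu$ for $F,G\in\mathcal A$, at least one of them in $\mathcal A_0$; and the diffusion property $\Gamma(\Psi(F_1,\dots,F_k),G)=\sum_j\partial_j\Psi(F_1,\dots,F_k)\,\Gamma(F_j,G)$,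 $L\Psi(F_1,\dots,F_k)=\sum_i\partial_i\Psi(F_1,\dots,F_k)\,LF_i+\sum_{i,j}\partial_{ij}\Psi(F_1,\dots,F_k)\,\Gamma(F_i,F_j)$ on $\mathcal A$. Let $\mathcal D(\mathcal E)\subseteq L^2(\mu)$ be the completion of $\mathcal A_0$ for the norm $(\|F\|_2^2+\int\Gamma(F,F)\,d\mu)^{1/2}$; extend $\Gamma$ by continuity to $\mathcal D(\mathcal E)\times\mathcal D(\mathcal E)\to L^1(\mu)$ and put $\mathcal E(F,G)=\int\Gamma(F,G)\,d\mu$. Let $\mathcal D(L)$ be the set of $F\in\mathcal D(\mathcal E)$ for which there is a finite $c_F$ with $|\mathcal E(F,G)|\le c_F\|G\|_2$ for all $G\in\mathcal D(\mathcal E)$, and extend $L$ to $\mathcal D(L)\to L^2(\mu)$ by $\int G\,LF\,d\mu=-\mathcal E(F,G)$ for all $G\in\mathcal D(\mathcal E)$. Assume $1\in\mathcal D(L)$, $L1=0$, and that $LF=0$, $F\in\mathcal D(L)$, implies that $F$ is constant. The pseudo-inverse $L^{-1}X$ of $X\in L^2(\mu)$ is defined when $X-\int X\,d\mu=LU$ for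 some $U\in\mathcal D(L)$; it is then the unique such $U$ with $\int U\,d\mu=0$. **Target law.** Let $-\infty\le l<u\le\infty$ and let $\nu$ be a probability measure on $\mathbb R$ with density $p$ that is positive and locally bounded on $(l,u)$ and zero elsewhere, with $\int|x|p(x)\,dx<\infty$ and mean $m$. For $\theta>0$ let $$\sigma^2(x)=\frac{-2\theta\int_{-\infty}^x(y-m)p(y)\,dy}{p(x)},\quad x\in(l,u),\qquad \tau(x)=\tfrac12\sigma^2(x)\mathbf 1_{(l,u)}(x),\quad x\in\mathbb R.$$ The *Stein-factor condition* on $\sigma^2$ is: if $u=\infty$ then $\liminf_{x\to u}\sigma^2(x)>0$; if $l=-\infty$ then $\liminf_{x\to l}\sigma^2(x)>0$; and there is a positive $g\in\mathcal C^1((l,u))$ such that, for $e=u$ and for $e=l$, $0<\liminf_{x\to e}\sigma^2(x)/g(x)\le\limsup_{x\to e}\sigma^2(x)/g(x)<\infty$ and $\lim_{x\to e}g'(x)$ exists in $[-\infty,\infty]$. **Distance.** Let $\mathscr H$ be a class of locally absolutely continuous functions $h:\mathbb R\to\mathbb R$ with $\sup_{h\in\mathscr H}\|h'\|_\infty<\infty$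 that is separating: two real random variables $X,Y$ with $h(X),h(Y)$ integrable and $\mathbb E h(X)=\mathbb E h(Y)$ for all $h\in\mathscr H$ have the same law. Put $d_{\mathscr H}(X,Y)=\sup_{h\in\mathscr H}|\mathbb E h(X)-\mathbb E h(Y)|$; it is admissible for $X,Y$ if $h(X),h(Y)$ are integrable for all $h\in\mathscr H$. **Theorem 3.2.** Given the target law $\nu$ and the class $\mathscr H$, there is a constant $c_{\mathscr H}>0$ such that, for every $\theta>0$ for which $\sigma^2$ satisfies the Stein-factor condition, every full Markov triple as above, every $G\in\mathcal D(L)$ for which $L^{-1}G$ is defined and such that $\int_E G\,d\mu=m$ and $\int_E\tau(G)\,d\mu<\infty$, and every random variable $Z$ with law $\nu$ such that $d_{\mathscr H}$ is admissible for $G$ and $Z$, $$d_{\mathscr H}(G,Z)\le c_{\mathscr H}\int_E\left|\Gamma(G,-L^{-1}G)-\theta^{-1}\tau(G)\right|d\mu .$$ -/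

import Mathlib

open MeasureTheory Filter Topology
open scoped ENNReal

noncomputable section

namespace CarreDuChamp

/-! ### Markov triples -/

/-- `∂ⱼΨ` for a function `Ψ` of `k` real variables. -/
def pderiv {k : ℕ} (j : Fin k) (Ψ : (Fin k → ℝ) → ℝ) : (Fin k → ℝ) → ℝ :=
  fun y => fderiv ℝ Ψ y (Pi.single j 1)

/-- The algebraic data of a Markov triple on the probability space `(E, μ)`: the algebras
`A₀ ⊆ A` of real random variables, the generator `L` and the carré du champ operator `Γ` on `A`,
related by integration by parts and satisfying the diffusion property. Identities between random
variables are only required to hold almost surely. -/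
structure PreMarkovTriple (E : Type*) [MeasurableSpace E] (μ : Measure E) where
  /-- The extended algebra (a unital algebra of random variables, without integrability). -/
  A : Subalgebra ℝ (E → ℝ)
  A_measurable : ∀ F ∈ A, Measurable F
  /-- `A` is stable under the action of smooth functions. -/
  A_smooth : ∀ (k : ℕ) (Ψ : (Fin k → ℝ) → ℝ), ContDiff ℝ ((⊤ : ℕ∞) : WithTop ℕ∞) Ψ →
    ∀ F : Fin k → A, (fun x => Ψ (fun i => (F i : E → ℝ) x)) ∈ A
  /-- The subalgebra `A₀`, an ideal of `A`. -/
  A₀ : Ideal A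
  /-- The elements of `A₀` are bounded. -/
  A₀_bounded : ∀ F ∈ A₀, ∃ C : ℝ, ∀ᵐ x ∂μ, |(F : E → ℝ) x| ≤ C
  /-- `A₀` is dense in `L^p` for every `p ∈ [1, ∞)`. -/
  A₀_dense : ∀ p : ℝ≥0∞, 1 ≤ p → p ≠ ∞ → ∀ f : Lp ℝ p μ, ∀ ε : ℝ≥0∞, 0 < ε →
    ∃ F ∈ A₀, eLpNorm (fun x => (F : E → ℝ) x - f x) p μ ≤ ε
  /-- `A₀` is stable under the action of smooth functions that vanish at the origin. -/
  A₀_smooth : ∀ (k : ℕ) (Ψ : (Fin k → ℝ) → ℝ), ContDiff ℝ ((⊤ : ℕ∞) : WithTop ℕ∞) Ψ → Ψ 0 = 0 →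
    ∀ F : Fin k → A, (∀ i, F i ∈ A₀) →
    ∀ Φ : A, (∀ x, (Φ : E → ℝ) x = Ψ (fun i => (F i : E → ℝ) x)) → Φ ∈ A₀
  /-- The generator on `A`. -/
  L : A →ₗ[ℝ] A
  /-- The carré du champ operator on `A`. -/
  Γ : A → A → A
  L_mem : ∀ F ∈ A₀, L F ∈ A₀
  Γ_mem : ∀ F ∈ A₀, ∀ G ∈ A₀, Γ F G ∈ A₀
  /-- `Γ(F, G) = (1/2) (L(FG) - F LG - G LF)`. -/
  Γ_eq : ∀ F G : A, ∀ᵐ x ∂μ, (Γ F G : E → ℝ) x =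
    (1 / 2) * ((L (F * G) : E → ℝ) x - (F : E → ℝ) x * (L G : E → ℝ) x
      - (G : E → ℝ) x * (L F : E → ℝ) x)
  Γ_nonneg : ∀ F : A, ∀ᵐ x ∂μ, 0 ≤ (Γ F F : E → ℝ) x
  Γ_eq_zero : ∀ F : A, (∀ᵐ x ∂μ, (Γ F F : E → ℝ) x = 0) ↔ ∃ c : ℝ, ∀ᵐ x ∂μ, (F : E → ℝ) x = c
  /-- `|∫ Γ(F, G) dμ| ≤ c_F ‖G‖₂` on `A₀`. -/
  Γ_bound : ∀ F ∈ A₀, ∃ c : ℝ, ∀ G ∈ A₀,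
    |∫ x, (Γ F G : E → ℝ) x ∂μ| ≤ c * Real.sqrt (∫ x, ((G : E → ℝ) x) ^ 2 ∂μ)
  /-- Integration by parts, when at least one of the two random variables is in `A₀`. -/
  integration_by_parts : ∀ F G : A, (F ∈ A₀ ∨ G ∈ A₀) →
    ∫ x, (G : E → ℝ) x * (L F : E → ℝ) x ∂μ = - ∫ x, (Γ F G : E → ℝ) x ∂μ
  /-- Diffusion property of `Γ`. -/
  diffusion_Γ : ∀ (k : ℕ) (Ψ : (Fin k → ℝ) → ℝ), ContDiff ℝ ((⊤ : ℕ∞) : WithTop ℕ∞) Ψ →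
    ∀ (F : Fin k → A) (G Φ : A), (∀ x, (Φ : E → ℝ) x = Ψ (fun i => (F i : E → ℝ) x)) →
    ∀ᵐ x ∂μ, (Γ Φ G : E → ℝ) x =
      ∑ j, pderiv j Ψ (fun i => (F i : E → ℝ) x) * (Γ (F j) G : E → ℝ) x
  /-- Diffusion property of `L`. -/
  diffusion_L : ∀ (k : ℕ) (Ψ : (Fin k → ℝ) → ℝ), ContDiff ℝ ((⊤ : ℕ∞) : WithTop ℕ∞) Ψ →
    ∀ (F : Fin k → A) (Φ : A), (∀ x, (Φ : E → ℝ) x = Ψ (fun i => (F i : E → ℝ) x)) →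
    ∀ᵐ x ∂μ, (L Φ : E → ℝ) x =
      ∑ i, pderiv i Ψ (fun i => (F i : E → ℝ) x) * (L (F i) : E → ℝ) x +
      ∑ i, ∑ j, pderiv i (pderiv j Ψ) (fun i => (F i : E → ℝ) x) *
        (Γ (F i) (F j) : E → ℝ) x

namespace PreMarkovTriple

variable {E : Type*} [MeasurableSpace E] {μ : Measure E} (M : PreMarkovTriple E μ)

/-- The sequence `F` in `A₀` converges to `f` in `L²` and is Cauchy for the Dirichlet form
`(F, G) ↦ ∫ Γ(F, G) dμ`, i.e. it represents `f` in the completion of `A₀` for the norm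
`(‖F‖₂² + ∫ Γ(F, F) dμ)^(1/2)`. -/
def IsApprox (F : ℕ → M.A) (f : Lp ℝ 2 μ) : Prop :=
  (∀ n, F n ∈ M.A₀) ∧
  Tendsto (fun n => eLpNorm (fun x => (F n : E → ℝ) x - f x) 2 μ) atTop (𝓝 0) ∧
  Tendsto (fun n : ℕ × ℕ =>
    ∫ x, (M.Γ (F n.1 - F n.2) (F n.1 - F n.2) : E → ℝ) x ∂μ) atTop (𝓝 0)

/-- The domain `D(𝓔) ⊆ L²` of the Dirichlet form. -/
def domE : Set (Lp ℝ 2 μ) := {f | ∃ F : ℕ → M.A, M.IsApprox F f}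

/-- `γ` is the value at `(f, g)` of the continuous extension of `Γ` to `D(𝓔) × D(𝓔) → L¹`. -/
def IsΓExt (f g : Lp ℝ 2 μ) (γ : Lp ℝ 1 μ) : Prop :=
  ∃ F G : ℕ → M.A, M.IsApprox F f ∧ M.IsApprox G g ∧
    Tendsto (fun n => eLpNorm (fun x => (M.Γ (F n) (G n) : E → ℝ) x - γ x) 1 μ) atTop (𝓝 0)

open Classical in
/-- The carré du champ operator `Γ : D(𝓔) × D(𝓔) → L¹` (and `0` off the domain). -/
def ΓExt (f g : Lp ℝ 2 μ) : Lp ℝ 1 μ :=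
  if h : ∃ γ, M.IsΓExt f g γ then h.choose else 0

/-- The Dirichlet form on `D(𝓔)`. -/
def form (f g : Lp ℝ 2 μ) : ℝ := ∫ x, M.ΓExt f g x ∂μ

/-- The domain `D(L)` of the generator. -/
def domL : Set (Lp ℝ 2 μ) :=
  {f | f ∈ M.domE ∧ ∃ c : ℝ, ∀ g ∈ M.domE, |M.form f g| ≤ c * ‖g‖}

open Classical in
/-- The generator on `D(L)`: the element `LExt f` of `L²` given by the integration by parts
formula `∫ g (L f) dμ = - 𝓔(f, g)` for all `g ∈ D(𝓔)` (and `0` off the domain). -/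
def LExt (f : Lp ℝ 2 μ) : Lp ℝ 2 μ :=
  if h : ∃ k : Lp ℝ 2 μ, ∀ g ∈ M.domE, ∫ x, g x * k x ∂μ = - M.form f g then h.choose else 0

end PreMarkovTriple

/-- A full Markov triple: `L²` is separable, `1 ∈ D(L)` with `L 1 = 0`, and `L` is ergodic. -/
structure MarkovTriple (E : Type*) [MeasurableSpace E] (μ : Measure E) [IsFiniteMeasure μ]
    extends PreMarkovTriple E μ where
  separable : TopologicalSpace.SeparableSpace (Lp ℝ 2 μ)
  one_mem : Lp.const 2 μ (1 : ℝ) ∈ toPreMarkovTriple.domL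
  L_one : toPreMarkovTriple.LExt (Lp.const 2 μ (1 : ℝ)) = 0
  ergodic : ∀ f ∈ toPreMarkovTriple.domL, toPreMarkovTriple.LExt f = 0 →
    ∃ c : ℝ, f = Lp.const 2 μ c

namespace MarkovTriple

variable {E : Type*} [MeasurableSpace E] {μ : Measure E} [IsFiniteMeasure μ]
  (M : MarkovTriple E μ)

/-- `X - π₀(X)`, where `π₀(X) = ∫ X dμ`. -/
def center (X : Lp ℝ 2 μ) : Lp ℝ 2 μ := X - Lp.const 2 μ (∫ x, X x ∂μ)

/-- `U = L⁻¹ X`: `U` is the centred element of `D(L)` with `L U = X - π₀(X)`. -/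
def IsPseudoInv (X U : Lp ℝ 2 μ) : Prop :=
  U ∈ M.domL ∧ ∫ x, U x ∂μ = 0 ∧ M.LExt U = center X

/-- `L⁻¹ X` is defined, i.e. `X - π₀(X)` is in the range of `L` on `D(L)`. -/
def InvDefined (X : Lp ℝ 2 μ) : Prop := ∃ U ∈ M.domL, M.LExt U = center X

open Classical in
/-- The pseudo-inverse `L⁻¹` of the generator (and `0` where it is not defined). -/
def LInv (X : Lp ℝ 2 μ) : Lp ℝ 2 μ :=
  if h : ∃ U, M.IsPseudoInv X U then h.choose else 0

end MarkovTriple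

/-! ### Target laws -/

/-- The open interval `(l, u)` of `ℝ` with possibly infinite endpoints. -/
def interval (l u : EReal) : Set ℝ := {x : ℝ | l < (x : EReal) ∧ (x : EReal) < u}

/-- `x → u` from the left in `ℝ`, where `u ∈ (-∞, ∞]`. -/
def toRight (u : EReal) : Filter ℝ := comap (fun x : ℝ => (x : EReal)) (𝓝[<] u)

/-- `x → l` from the right in `ℝ`, where `l ∈ [-∞, ∞)`. -/
def toLeft (l : EReal) : Filter ℝ := comap (fun x : ℝ => (x : EReal)) (𝓝[>] l)

/-- `p` is a probability density with support `(l, u)`, positive and locally bounded there, and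
with a finite first moment. -/
structure IsTargetDensity (p : ℝ → ℝ) (l u : EReal) : Prop where
  lt : l < u
  measurable : Measurable p
  pos : ∀ x ∈ interval l u, 0 < p x
  zero : ∀ x, x ∉ interval l u → p x = 0
  locally_bounded : ∀ x ∈ interval l u, ∃ C : ℝ, ∀ᶠ y in 𝓝 x, p y ≤ C
  lintegral_eq_one : ∫⁻ x, ENNReal.ofReal (p x) = 1
  first_moment : Integrable (fun x => x * p x)

/-- The law with density `p`. -/
def law (p : ℝ → ℝ) : Measure ℝ := volume.withDensity (fun x => ENNReal.ofReal (p x))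

/-- The mean `m` of the law with density `p`. -/
def mean (p : ℝ → ℝ) : ℝ := ∫ x, x * p x

/-- `σ²(x) = -2θ ∫_{-∞}^x (y - m) p(y) dy / p(x)`, used for `x ∈ (l, u)`. -/
def sigmaSq (p : ℝ → ℝ) (θ x : ℝ) : ℝ :=
  (-2 * θ * ∫ y in Set.Iic x, (y - mean p) * p y) / p x

/-- `τ = (1/2) σ² 1_{(l, u)}`. -/
def tau (p : ℝ → ℝ) (l u : EReal) (θ : ℝ) : ℝ → ℝ :=
  (interval l u).indicator (fun x => (1 / 2) * sigmaSq p θ x)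

/-- The conditions on `s = σ²` under which the derivatives of the solutions of the Stein
equation are controlled. Lower and upper limits are taken in `[-∞, ∞]`. -/
structure SteinFactorCondition (s : ℝ → ℝ) (l u : EReal) : Prop where
  right_pos : u = ⊤ → 0 < liminf (fun x => ((s x : ℝ) : EReal)) (toRight u)
  left_pos : l = ⊥ → 0 < liminf (fun x => ((s x : ℝ) : EReal)) (toLeft l)
  comparison : ∃ g : ℝ → ℝ, ContDiffOn ℝ 1 g (interval l u) ∧ (∀ x ∈ interval l u, 0 < g x) ∧
    0 < liminf (fun x => ((s x / g x : ℝ) : EReal)) (toRight u) ∧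
    limsup (fun x => ((s x / g x : ℝ) : EReal)) (toRight u) < ⊤ ∧
    (∃ a : EReal, Tendsto (fun x => ((deriv g x : ℝ) : EReal)) (toRight u) (𝓝 a)) ∧
    0 < liminf (fun x => ((s x / g x : ℝ) : EReal)) (toLeft l) ∧
    limsup (fun x => ((s x / g x : ℝ) : EReal)) (toLeft l) < ⊤ ∧
    (∃ a : EReal, Tendsto (fun x => ((deriv g x : ℝ) : EReal)) (toLeft l) (𝓝 a))

/-! ### Probabilistic distances -/

/-- The class `H` separates the laws of real random variables. -/
def Separating (H : Set (ℝ → ℝ)) : Prop :=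
  ∀ P Q : Measure ℝ, IsProbabilityMeasure P → IsProbabilityMeasure Q →
    (∀ h ∈ H, Integrable h P ∧ Integrable h Q ∧ ∫ x, h x ∂P = ∫ x, h x ∂Q) → P = Q

/-- The distance `d_H(X, Y) = sup_{h ∈ H} |E h(X) - E h(Y)|`, where `X` and `Y` may live on
different probability spaces. -/
def probDist {Ω Ω' : Type*} [MeasurableSpace Ω] [MeasurableSpace Ω'] (H : Set (ℝ → ℝ))
    (X : Ω → ℝ) (P : Measure Ω) (Y : Ω' → ℝ) (P' : Measure Ω') : ℝ≥0∞ :=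
  ⨆ h ∈ H, ENNReal.ofReal |∫ ω, h (X ω) ∂P - ∫ ω, h (Y ω) ∂P'|

/-- The distance `d_H` is admissible for `X` and `Y`: `h(X)` and `h(Y)` are integrable for every
`h ∈ H`. -/
def Admissible {Ω Ω' : Type*} [MeasurableSpace Ω] [MeasurableSpace Ω'] (H : Set (ℝ → ℝ))
    (X : Ω → ℝ) (P : Measure Ω) (Y : Ω' → ℝ) (P' : Measure Ω') : Prop :=
  ∀ h ∈ H, Integrable (fun ω => h (X ω)) P ∧ Integrable (fun ω => h (Y ω)) P'

end CarreDuChamp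

end

/-! This is Stein's method combined with integration by parts. Write `D(x) = ∫ₓ^∞ (y - m) p(y) dy`
and let `a = D / p` be the Stein kernel of `ν`. Then `σ² = 2θa` on `(l, u)`, so `θ⁻¹ τ = a ·
1_{(l,u)}` and `θ` drops out. For `h` in the class put `b = h - ∫ h dν` and let `f` solve `a
1_{(l,u)} f' - (x - m) f = b`. Since `G - m = L L⁻¹G`, integration by parts and the chain rule give
`E[(G - m) f(G)] = E[f'(G) Γ(G, -L⁻¹G)]`. Hence `E b(G) = -E[f'(G) (Γ(G, -L⁻¹G) - a(G)
1_{(l,u)}(G))]`, and it remains to bound `f'` by a constant, depending only on `p`, times the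
Lipschitz constant of `h`.

The law of `G` is arbitrary: it may have atoms or charge the complement of `(l, u)`. So the equation
must hold at every point, with a fixed everywhere-defined version `φ` of `f'`. Off `(l, u)` the
equation is algebraic and forces `f = -b / (x - m)`; the result is still globally Lipschitz
(`exists_steinSol_bounds`). Integration by parts is needed for primitives of arbitrary bounded
measurable `φ` (`integral_primitive_mul_LExt`). It is proved for smooth functions by approximation
in the Dirichlet domain and extended to measurable `φ` by a monotone class argument.

Inside `(l, u)`, `f(x) = -∫ₓ^∞ b p / D(x)` and `f' = (b + (x - m) f) / a`. Multiplying the numerator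
by `D(x)` gives `∫ₓ^∞ (b(x)(y - m) - b(y)(x - m)) p(y) dy`. For Lipschitz centred `b` the bracket is
at most a multiple of `(x - m)(y - x)` once `x` is away from `m`. So the Stein factor reduces to `(x
- m) ∫ₓ^∞ (y - x) p ≤ C a(x) D(x)` near `u` (`exists_mul_tail_le`), which is where the comparison
function `g` is used; compactness handles the rest of `[m, u)`, and reflection handles the left
side. -/

namespace CarreDuChamp

/-! ### Closable energy forms and their extension by continuity. -/

/-- A nonnegative symmetric bilinear form `v ↦ int (Γ v v)`, with a density `Γ` in a space `W` of
integrable functions, on a space `V` embedded in `H`, which is closable as a form on `H`. -/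
structure EnergyForm (V H W : Type*) [AddCommGroup V] [Module ℝ V] [NormedAddCommGroup H]
    [NormedSpace ℝ H] [NormedAddCommGroup W] [NormedSpace ℝ W] where
  emb : V →ₗ[ℝ] H
  Γ : V →ₗ[ℝ] V →ₗ[ℝ] W
  int : W →L[ℝ] ℝ
  symm : ∀ u v, Γ u v = Γ v u
  nonneg : ∀ v, 0 ≤ int (Γ v v)
  abs_int_le : ∀ w, |int w| ≤ ‖w‖
  norm_Γ_le : ∀ u v, ‖Γ u v‖ ≤ √(int (Γ u u)) * √(int (Γ v v))
  closable : ∀ u, ∃ c : ℝ, ∀ v, |int (Γ u v)| ≤ c * ‖emb v‖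

namespace EnergyForm

variable {V H W : Type*} [AddCommGroup V] [Module ℝ V] [NormedAddCommGroup H]
    [NormedSpace ℝ H] [NormedAddCommGroup W] [NormedSpace ℝ W] (B : EnergyForm V H W)

/-- The seminorm of the energy form. -/
noncomputable def nrm (v : V) : ℝ := √(B.int (B.Γ v v))

theorem nrm_nonneg (v : V) : 0 ≤ B.nrm v := Real.sqrt_nonneg _

theorem nrm_sq (v : V) : B.nrm v ^ 2 = B.int (B.Γ v v) := Real.sq_sqrt (B.nonneg v)

theorem norm_Γ_le_nrm (u v : V) : ‖B.Γ u v‖ ≤ B.nrm u * B.nrm v := B.norm_Γ_le u v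

theorem nrm_smul (c : ℝ) (v : V) : B.nrm (c • v) = |c| * B.nrm v := by
  rw [nrm, nrm]
  simp only [map_smul, LinearMap.smul_apply, smul_eq_mul]
  rw [← mul_assoc, ← sq, Real.sqrt_mul (sq_nonneg c), Real.sqrt_sq_eq_abs]

theorem nrm_zero : B.nrm 0 = 0 := by simp [nrm]

theorem nrm_add_le (u v : V) : B.nrm (u + v) ≤ B.nrm u + B.nrm v := by
  refine abs_le_of_sq_le_sq' ?_ (add_nonneg (B.nrm_nonneg u) (B.nrm_nonneg v)) |>.2
  have h := (le_abs_self _).trans ((B.abs_int_le (B.Γ u v)).trans (B.norm_Γ_le_nrm u v))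
  have e : B.nrm (u + v) ^ 2 = B.nrm u ^ 2 + 2 * B.int (B.Γ u v) + B.nrm v ^ 2 := by
    rw [nrm_sq, nrm_sq, nrm_sq]
    simp only [map_add, LinearMap.add_apply, B.symm v u]
    ring
  rw [e]; nlinarith

/-- The sequence `F` converges to `f` in `H` and is Cauchy for the energy. -/
def Approx (F : ℕ → V) (f : H) : Prop :=
  Tendsto (fun n => B.emb (F n)) atTop (𝓝 f) ∧
  Tendsto (fun n : ℕ × ℕ => B.nrm (F n.1 - F n.2)) atTop (𝓝 0)

variable {B} {F F' G G' : ℕ → V} {f g : H}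

theorem Approx.const (v : V) : B.Approx (fun _ => v) (B.emb v) :=
  ⟨tendsto_const_nhds, by simp [nrm_zero]⟩

theorem Approx.smul (c : ℝ) (hF : B.Approx F f) : B.Approx (fun n => c • F n) (c • f) := by
  refine ⟨by simpa using hF.1.const_smul c, ?_⟩
  simpa [← smul_sub, nrm_smul] using hF.2.const_mul |c|

theorem Approx.add (hF : B.Approx F f) (hG : B.Approx G g) :
    B.Approx (fun n => F n + G n) (f + g) := by
  refine ⟨by simpa using hF.1.add hG.1, ?_⟩
  refine squeeze_zero (fun _ => B.nrm_nonneg _) (fun n => ?_) (by simpa using hF.2.add hG.2)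
  rw [add_sub_add_comm]
  exact B.nrm_add_le _ _

theorem Approx.neg (hF : B.Approx F f) : B.Approx (fun n => -F n) (-f) := by
  simpa using hF.smul (-1)

theorem Approx.sub (hF : B.Approx F f) (hG : B.Approx G g) :
    B.Approx (fun n => F n - G n) (f - g) := by
  simpa [sub_eq_add_neg] using hF.add hG.neg

theorem Approx.eventually_nrm_le (hF : B.Approx F f) : ∃ C, ∀ᶠ n in atTop, B.nrm (F n) ≤ C := by
  have h := hF.2.eventually (gt_mem_nhds one_pos)
  rw [eventually_atTop] at h
  obtain ⟨⟨a, b⟩, h⟩ := h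
  refine ⟨1 + B.nrm (F (max a b)), eventually_atTop.2 ⟨max a b, fun n hn => ?_⟩⟩
  have h1 := h (n, max a b) ⟨(le_max_left a b).trans hn, le_max_right a b⟩
  calc B.nrm (F n) = B.nrm ((F n - F (max a b)) + F (max a b)) := by simp
    _ ≤ _ := B.nrm_add_le _ _
    _ ≤ _ := by gcongr

/-- This is closability. Split `Γ(Fₙ, Fₙ) = Γ(Fₙ, Fₙ - Fₘ) + Γ(Fₙ, Fₘ)`: the first term is small by
the Cauchy property, and for fixed `n` the second vanishes as `m → ∞` because `Γ(Fₙ, ·)` is bounded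
for the norm of `H`. -/
theorem Approx.tendsto_nrm_zero (hF : B.Approx F 0) :
    Tendsto (fun n => B.nrm (F n)) atTop (𝓝 0) := by
  refine tendsto_order.2 ⟨fun a ha => Eventually.of_forall fun n => ha.trans_le (B.nrm_nonneg _),
    fun ε hε => ?_⟩
  have h := hF.2.eventually (gt_mem_nhds (half_pos hε))
  rw [eventually_atTop] at h
  obtain ⟨⟨a, b⟩, h⟩ := h
  refine eventually_atTop.2 ⟨a, fun n hn => ?_⟩
  obtain ⟨c, hc⟩ := B.closable (F n)
  have key : ∀ᶠ m in atTop, B.nrm (F n) ^ 2 ≤ B.nrm (F n) * (ε / 2) + c * ‖B.emb (F m)‖ := by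
    filter_upwards [eventually_ge_atTop b] with m hm
    have e : B.nrm (F n) ^ 2 = B.int (B.Γ (F n) (F n - F m)) + B.int (B.Γ (F n) (F m)) := by
      rw [nrm_sq]; simp
    have h1 := (le_abs_self _).trans
      ((B.abs_int_le (B.Γ (F n) (F n - F m))).trans (B.norm_Γ_le_nrm _ _))
    have h2 := (le_abs_self _).trans (hc (F m))
    have h3 := mul_le_mul_of_nonneg_left (h (n, m) ⟨hn, hm⟩).le (B.nrm_nonneg (F n))
    rw [e]; exact add_le_add (h1.trans h3) h2
  have lim : Tendsto (fun m => B.nrm (F n) * (ε / 2) + c * ‖B.emb (F m)‖) atTop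
      (𝓝 (B.nrm (F n) * (ε / 2) + c * 0)) := by
    have := hF.1.norm
    rw [norm_zero] at this
    exact (this.const_mul c).const_add _
  have := ge_of_tendsto lim key
  nlinarith [B.nrm_nonneg (F n)]

theorem norm_Γ_sub_le (u v u' v' : V) : ‖B.Γ u v - B.Γ u' v'‖ ≤
    B.nrm (u - u') * B.nrm v + B.nrm u' * B.nrm (v - v') := by
  have : B.Γ u v - B.Γ u' v' = B.Γ (u - u') v + B.Γ u' (v - v') := by simp
  rw [this]
  exact (norm_add_le _ _).trans (add_le_add (B.norm_Γ_le_nrm _ _) (B.norm_Γ_le_nrm _ _))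

/-- The limit is taken with the two indices independent, so that iterated limits can be extracted
later. -/
theorem Approx.exists_tendsto [CompleteSpace W] (hF : B.Approx F f) (hG : B.Approx G g) :
    ∃ γ, Tendsto (fun n : ℕ × ℕ => B.Γ (F n.1) (G n.2)) atTop (𝓝 γ) := by
  obtain ⟨C, hC⟩ := hF.eventually_nrm_le
  obtain ⟨D, hD⟩ := hG.eventually_nrm_le
  refine cauchySeq_tendsto_of_complete ?_
  rw [Metric.cauchySeq_iff]
  intro ε hε
  have hp : 0 < |C| + |D| + 1 := by positivity
  have hδ : 0 < ε / (|C| + |D| + 1) := div_pos hε hp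
  obtain ⟨⟨a, b⟩, h1⟩ := eventually_atTop.1 (hF.2.eventually (gt_mem_nhds hδ))
  obtain ⟨⟨a', b'⟩, h2⟩ := eventually_atTop.1 (hG.2.eventually (gt_mem_nhds hδ))
  obtain ⟨c, h3⟩ := eventually_atTop.1 hC
  obtain ⟨d, h4⟩ := eventually_atTop.1 hD
  refine ⟨(max a (max b c), max a' (max b' d)), fun n hn m hm => ?_⟩
  simp only [ge_iff_le, Prod.le_def, max_le_iff] at hn hm
  rw [dist_eq_norm]
  refine (norm_Γ_sub_le _ _ _ _).trans_lt ?_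
  have e1 := h1 (n.1, m.1) ⟨hn.1.1, hm.1.2.1⟩
  have e2 := h2 (n.2, m.2) ⟨hn.2.1, hm.2.2.1⟩
  have e3 := h3 m.1 hm.1.2.2
  have e4 := h4 n.2 hn.2.2.2
  simp only at e1 e2
  calc _ ≤ ε / (|C| + |D| + 1) * |D| + |C| * (ε / (|C| + |D| + 1)) := by
        gcongr
        · exact B.nrm_nonneg _
        · exact e4.trans (le_abs_self _)
        · exact B.nrm_nonneg _
        · exact e3.trans (le_abs_self _)
    _ = ε * ((|C| + |D|) / (|C| + |D| + 1)) := by ring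
    _ < ε * 1 := by
        gcongr
        rw [div_lt_one hp]; linarith
    _ = ε := mul_one ε

/-- Two approximations of one element differ by an approximation of `0`, whose energy tends to `0`.
This makes the extension of `Γ` independent of the chosen sequences. -/
theorem Approx.tendsto_unique {γ : W} (hF : B.Approx F f) (hG : B.Approx G g)
    (hF' : B.Approx F' f) (hG' : B.Approx G' g)
    (h : Tendsto (fun n => B.Γ (F n) (G n)) atTop (𝓝 γ)) :
    Tendsto (fun n => B.Γ (F' n) (G' n)) atTop (𝓝 γ) := by
  obtain ⟨C, hC⟩ := hF.eventually_nrm_le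
  obtain ⟨D, hD⟩ := hG'.eventually_nrm_le
  have h1 : Tendsto (fun n => B.nrm (F' n - F n)) atTop (𝓝 0) :=
    Approx.tendsto_nrm_zero (by simpa using hF'.sub hF)
  have h2 : Tendsto (fun n => B.nrm (G' n - G n)) atTop (𝓝 0) :=
    Approx.tendsto_nrm_zero (by simpa using hG'.sub hG)
  have h3 : Tendsto (fun n => B.Γ (F' n) (G' n) - B.Γ (F n) (G n)) atTop (𝓝 0) := by
    refine squeeze_zero_norm' (a := fun n => B.nrm (F' n - F n) * D + C * B.nrm (G' n - G n)) ?_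
      (by simpa using (h1.mul_const D).add (h2.const_mul C))
    filter_upwards [hC, hD] with n hn hn'
    refine (norm_Γ_sub_le _ _ _ _).trans ?_
    gcongr <;> exact B.nrm_nonneg _
  simpa using h3.add h

end EnergyForm

/-- Cauchy–Schwarz by the discriminant of `t ↦ b t² - 2xt + a`, which is nonnegative for `t ≤ 0` by
signs alone. Optimising in `t` only after integration avoids a pointwise Cauchy–Schwarz inequality
for a `Γ` that is bilinear only almost surely. -/
theorem le_sqrt_mul_sqrt_of_forall {a b x : ℝ} (ha : 0 ≤ a) (hx : 0 ≤ x)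
    (h : ∀ t, 0 < t → 2 * t * x ≤ a + t ^ 2 * b) (hb : 0 ≤ b) : x ≤ √a * √b := by
  have key : ∀ t : ℝ, 0 ≤ b * (t * t) + (-(2 * x)) * t + a := by
    intro t
    rcases le_or_gt t 0 with ht | ht
    · nlinarith [mul_nonneg hx (neg_nonneg.2 ht), mul_nonneg hb (mul_self_nonneg t)]
    · nlinarith [h t ht]
  have := discrim_le_zero key
  rw [discrim] at this
  rw [← Real.sqrt_mul ha]
  exact Real.le_sqrt_of_sq_le (by nlinarith)

/-! ### The energy form of a Markov triple, and the generator on `D(L)`. -/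

namespace PreMarkovTriple

variable {E : Type*} [MeasurableSpace E] {μ : Measure E} (M : PreMarkovTriple E μ)

theorem memLp_of_mem_A₀ [IsFiniteMeasure μ] {F : M.A} (hF : F ∈ M.A₀) (p : ℝ≥0∞) :
    MemLp (F : E → ℝ) p μ := by
  obtain ⟨C, hC⟩ := M.A₀_bounded F hF
  exact MemLp.of_bound (M.A_measurable F F.2).aestronglyMeasurable C hC

theorem memLp_Γ [IsFiniteMeasure μ] {F G : M.A} (hF : F ∈ M.A₀) (hG : G ∈ M.A₀) (p : ℝ≥0∞) :
    MemLp (M.Γ F G : E → ℝ) p μ :=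
  M.memLp_of_mem_A₀ (M.Γ_mem F hF G hG) p

theorem Γ_symm (F G : M.A) : (M.Γ F G : E → ℝ) =ᵐ[μ] (M.Γ G F : E → ℝ) := by
  filter_upwards [M.Γ_eq F G, M.Γ_eq G F] with x h1 h2
  rw [h1, h2, mul_comm F G]; ring

theorem Γ_add_left (F F' G : M.A) :
    (M.Γ (F + F') G : E → ℝ) =ᵐ[μ] fun x => (M.Γ F G : E → ℝ) x + (M.Γ F' G : E → ℝ) x := by
  filter_upwards [M.Γ_eq F G, M.Γ_eq F' G, M.Γ_eq (F + F') G] with x h1 h2 h3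
  rw [h1, h2, h3, add_mul, map_add, map_add]
  simp only [Subalgebra.coe_add, Pi.add_apply]; ring

theorem Γ_smul_left (c : ℝ) (F G : M.A) :
    (M.Γ (c • F) G : E → ℝ) =ᵐ[μ] fun x => c * (M.Γ F G : E → ℝ) x := by
  filter_upwards [M.Γ_eq F G, M.Γ_eq (c • F) G] with x h1 h2
  rw [h1, h2, smul_mul_assoc, map_smul, map_smul]
  simp only [Subalgebra.coe_smul, Pi.smul_apply, smul_eq_mul]; ring

theorem Γ_add_right (F G G' : M.A) :
    (M.Γ F (G + G') : E → ℝ) =ᵐ[μ] fun x => (M.Γ F G : E → ℝ) x + (M.Γ F G' : E → ℝ) x := by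
  filter_upwards [M.Γ_symm F (G + G'), M.Γ_add_left G G' F, M.Γ_symm F G, M.Γ_symm F G']
    with x h1 h2 h3 h4
  rw [h1, h2, h3, h4]

theorem Γ_smul_right (c : ℝ) (F G : M.A) :
    (M.Γ F (c • G) : E → ℝ) =ᵐ[μ] fun x => c * (M.Γ F G : E → ℝ) x := by
  filter_upwards [M.Γ_symm F (c • G), M.Γ_smul_left c G F, M.Γ_symm F G] with x h1 h2 h3
  rw [h1, h2, h3]

/-- Expand `Γ(F ± tG, F ± tG) ≥ 0`. -/
theorem two_mul_abs_Γ_le (F G : M.A) (t : ℝ) : ∀ᵐ x ∂μ,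
    2 * t * |(M.Γ F G : E → ℝ) x| ≤ (M.Γ F F : E → ℝ) x + t ^ 2 * (M.Γ G G : E → ℝ) x := by
  have key : ∀ s : ℝ, ∀ᵐ x ∂μ, 0 ≤ (M.Γ F F : E → ℝ) x + 2 * s * (M.Γ F G : E → ℝ) x +
      s ^ 2 * (M.Γ G G : E → ℝ) x := by
    intro s
    filter_upwards [M.Γ_nonneg (F + s • G), M.Γ_add_left F (s • G) (F + s • G),
      M.Γ_add_right F F (s • G), M.Γ_add_right (s • G) F (s • G), M.Γ_smul_right s F G,
      M.Γ_smul_left s G F, M.Γ_smul_left s G (s • G), M.Γ_smul_right s G G,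
      M.Γ_symm F G] with x h0 h1 h2 h3 h4 h5 h6 h7 h8
    rw [h1, h2, h3, h4, h5, h6, h7, ← h8] at h0
    linarith
  filter_upwards [key t, key (-t)] with x h1 h2
  rcases abs_cases ((M.Γ F G : E → ℝ) x) with h | h <;> rw [h.1] <;> nlinarith

theorem integral_mul_eq_inner (f g : Lp ℝ 2 μ) : ∫ x, f x * g x ∂μ = inner ℝ g f := by
  rw [L2.inner_def]; simp

theorem form_eq (f g : Lp ℝ 2 μ) : M.form f g = L1.integralCLM (M.ΓExt f g) := by
  rw [form, ← L1.integral_eq, L1.integral_eq_integral]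

variable [IsFiniteMeasure μ]

/-- The absolute value is inside the integral: this controls the `L¹` norm of `Γ(F, G)`, not just
the Dirichlet form, and so makes `Γ` extend with values in `L¹`. -/
theorem integral_abs_Γ_le {F G : M.A} (hF : F ∈ M.A₀) (hG : G ∈ M.A₀) :
    ∫ x, |(M.Γ F G : E → ℝ) x| ∂μ ≤
      √(∫ x, (M.Γ F F : E → ℝ) x ∂μ) * √(∫ x, (M.Γ G G : E → ℝ) x ∂μ) := by
  have i1 := (M.memLp_Γ hF hF 1).integrable le_rfl
  have i2 := (M.memLp_Γ hG hG 1).integrable le_rfl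
  have i3 := (M.memLp_Γ hF hG 1).integrable le_rfl
  refine le_sqrt_mul_sqrt_of_forall (integral_nonneg_of_ae (M.Γ_nonneg F))
    (integral_nonneg fun _ => abs_nonneg _) (fun t _ => ?_)
    (integral_nonneg_of_ae (M.Γ_nonneg G))
  rw [← integral_const_mul, ← integral_const_mul, ← integral_add i1 (i2.const_mul _)]
  exact integral_mono_ae (i3.abs.const_mul _) (i1.add (i2.const_mul _)) (M.two_mul_abs_Γ_le F G t)

/-- The embedding of `A₀` in `L²`. -/
noncomputable def toL2 : M.A₀ →ₗ[ℝ] Lp ℝ 2 μ where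
  toFun F := (M.memLp_of_mem_A₀ F.2 2).toLp
  map_add' F G := (MemLp.toLp_add (M.memLp_of_mem_A₀ F.2 2) (M.memLp_of_mem_A₀ G.2 2)).symm ▸ rfl
  map_smul' c F := (MemLp.toLp_const_smul c (M.memLp_of_mem_A₀ F.2 2)).symm ▸ rfl

/-- The carré du champ operator on `A₀`, with values in `L¹`. -/
noncomputable def ΓL1 : M.A₀ →ₗ[ℝ] M.A₀ →ₗ[ℝ] Lp ℝ 1 μ :=
  LinearMap.mk₂ ℝ (fun F G => (M.memLp_Γ F.2 G.2 1).toLp)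
    (fun F F' G => by
      rw [← MemLp.toLp_add]
      exact MemLp.toLp_congr _ _ (M.Γ_add_left F F' G))
    (fun c F G => by
      rw [← MemLp.toLp_const_smul]
      exact MemLp.toLp_congr _ _ (M.Γ_smul_left c F G))
    (fun F G G' => by
      rw [← MemLp.toLp_add]
      exact MemLp.toLp_congr _ _ (M.Γ_add_right F G G'))
    (fun c F G => by
      rw [← MemLp.toLp_const_smul]
      exact MemLp.toLp_congr _ _ (M.Γ_smul_right c F G))

theorem coeFn_ΓL1 (F G : M.A₀) : M.ΓL1 F G =ᵐ[μ] (M.Γ F G : E → ℝ) :=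
  MemLp.coeFn_toLp (M.memLp_Γ F.2 G.2 1)

theorem coeFn_toL2 (F : M.A₀) : M.toL2 F =ᵐ[μ] ((F : M.A) : E → ℝ) :=
  MemLp.coeFn_toLp (M.memLp_of_mem_A₀ F.2 2)

theorem integralCLM_ΓL1 (F G : M.A₀) :
    (L1.integralCLM (M.ΓL1 F G) : ℝ) = ∫ x, (M.Γ F G : E → ℝ) x ∂μ := by
  rw [← L1.integral_eq, L1.integral_eq_integral]
  exact integral_congr_ae (M.coeFn_ΓL1 F G)

/-- The energy form of a Markov triple. -/
noncomputable def energyForm : EnergyForm M.A₀ (Lp ℝ 2 μ) (Lp ℝ 1 μ) where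
  emb := M.toL2
  Γ := M.ΓL1
  int := L1.integralCLM
  symm F G :=
    MemLp.toLp_congr (M.memLp_Γ F.2 G.2 1) (M.memLp_Γ G.2 F.2 1) (M.Γ_symm F G)
  nonneg F := by
    rw [integralCLM_ΓL1]
    exact integral_nonneg_of_ae (M.Γ_nonneg F)
  abs_int_le w := by
    rw [← L1.integral_eq]
    exact L1.norm_integral_le w
  norm_Γ_le F G := by
    rw [integralCLM_ΓL1, integralCLM_ΓL1, L1.norm_eq_integral_norm]
    refine (le_of_eq (integral_congr_ae ?_)).trans (M.integral_abs_Γ_le F.2 G.2)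
    filter_upwards [M.coeFn_ΓL1 F G] with x hx
    rw [hx, Real.norm_eq_abs]
  closable F := by
    obtain ⟨c, hc⟩ := M.Γ_bound F F.2
    refine ⟨c, fun G => ?_⟩
    rw [integralCLM_ΓL1]
    refine (hc G G.2).trans_eq ?_
    rw [@norm_eq_sqrt_real_inner (Lp ℝ 2 μ), L2.inner_def]
    congr 2
    refine integral_congr_ae ?_
    filter_upwards [M.coeFn_toL2 G] with x hx
    rw [hx]; simp [sq]

theorem isApprox_iff {F : ℕ → M.A₀} {f : Lp ℝ 2 μ} :
    M.IsApprox (fun n => (F n : M.A)) f ↔ M.energyForm.Approx F f := by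
  have h1 : (fun n => eLpNorm (fun x => ((F n : M.A) : E → ℝ) x - f x) 2 μ) =
      fun n => eLpNorm (⇑(M.energyForm.emb (F n)) - ⇑f) 2 μ := by
    ext n
    refine eLpNorm_congr_ae ?_
    filter_upwards [M.coeFn_toL2 (F n)] with x hx
    rw [Pi.sub_apply, ← hx]; rfl
  have h2 : (fun n : ℕ × ℕ => ∫ x, (M.Γ ((F n.1 : M.A) - F n.2) (F n.1 - F n.2) : E → ℝ) x ∂μ) =
      fun n : ℕ × ℕ => M.energyForm.nrm (F n.1 - F n.2) ^ 2 := by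
    ext n
    rw [EnergyForm.nrm_sq]
    exact (M.integralCLM_ΓL1 (F n.1 - F n.2) (F n.1 - F n.2)).symm
  rw [IsApprox, EnergyForm.Approx, h1, h2, Lp.tendsto_Lp_iff_tendsto_eLpNorm']
  -- `IsApprox` measures the energy, which is the square of the seminorm in `Approx`.
  refine ⟨fun ⟨_, h, h'⟩ => ⟨h, ?_⟩, fun ⟨h, h'⟩ => ⟨fun n => (F n).2, h, ?_⟩⟩
  · have := h'.sqrt
    simpa [Real.sqrt_sq (EnergyForm.nrm_nonneg _ _)] using this
  · simpa using h'.pow 2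

theorem mem_domE_iff {f : Lp ℝ 2 μ} : f ∈ M.domE ↔ ∃ F, M.energyForm.Approx F f := by
  constructor
  · rintro ⟨F, hF⟩
    exact ⟨fun n => ⟨F n, hF.1 n⟩, M.isApprox_iff.1 hF⟩
  · rintro ⟨F, hF⟩
    exact ⟨_, M.isApprox_iff.2 hF⟩

theorem isΓExt_iff {f g : Lp ℝ 2 μ} {γ : Lp ℝ 1 μ} : M.IsΓExt f g γ ↔
    ∃ F G, M.energyForm.Approx F f ∧ M.energyForm.Approx G g ∧
      Tendsto (fun n => M.ΓL1 (F n) (G n)) atTop (𝓝 γ) := by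
  have key : ∀ F G : ℕ → M.A₀,
      Tendsto (fun n => eLpNorm (fun x => (M.Γ (F n) (G n) : E → ℝ) x - γ x) 1 μ) atTop (𝓝 0) ↔
      Tendsto (fun n => M.ΓL1 (F n) (G n)) atTop (𝓝 γ) := by
    intro F G
    rw [Lp.tendsto_Lp_iff_tendsto_eLpNorm']
    refine Filter.tendsto_congr fun n => eLpNorm_congr_ae ?_
    filter_upwards [M.coeFn_ΓL1 (F n) (G n)] with x hx
    rw [Pi.sub_apply, ← hx]
  constructor
  · rintro ⟨F, G, hF, hG, h⟩
    exact ⟨fun n => ⟨F n, hF.1 n⟩, fun n => ⟨G n, hG.1 n⟩, M.isApprox_iff.1 hF,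
      M.isApprox_iff.1 hG, (key _ _).1 h⟩
  · rintro ⟨F, G, hF, hG, h⟩
    exact ⟨_, _, M.isApprox_iff.2 hF, M.isApprox_iff.2 hG, (key _ _).2 h⟩

variable {M} {f f' g g' : Lp ℝ 2 μ}

/-- The value picked by choice in `ΓExt` comes from some pair of approximating sequences; by
uniqueness it is the limit along every pair. -/
theorem tendsto_ΓExt {F G : ℕ → M.A₀} (hF : M.energyForm.Approx F f)
    (hG : M.energyForm.Approx G g) :
    Tendsto (fun n : ℕ × ℕ => M.ΓL1 (F n.1) (G n.2)) atTop (𝓝 (M.ΓExt f g)) := by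
  have diag : Tendsto (fun n : ℕ => (n, n)) atTop atTop := tendsto_atTop_diagonal
  obtain ⟨γ, hγ⟩ := hF.exists_tendsto hG
  have ex : ∃ γ, M.IsΓExt f g γ := ⟨γ, M.isΓExt_iff.2 ⟨F, G, hF, hG, hγ.comp diag⟩⟩
  obtain ⟨F', G', hF', hG', h'⟩ := M.isΓExt_iff.1 ex.choose_spec
  have h := EnergyForm.Approx.tendsto_unique hF' hG' hF hG h'
  have e : M.ΓExt f g = ex.choose := by rw [ΓExt, dif_pos ex]
  rw [e, ← tendsto_nhds_unique (hγ.comp diag) h]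
  exact hγ

theorem tendsto_ΓExt_diag {F G : ℕ → M.A₀} (hF : M.energyForm.Approx F f)
    (hG : M.energyForm.Approx G g) :
    Tendsto (fun n => M.ΓL1 (F n) (G n)) atTop (𝓝 (M.ΓExt f g)) :=
  (tendsto_ΓExt hF hG).comp (tendsto_atTop_diagonal (α := ℕ))

variable (M)

/-- The domain of the Dirichlet form as a subspace. -/
def domESubmodule : Submodule ℝ (Lp ℝ 2 μ) where
  carrier := M.domE
  add_mem' hf hg := by
    obtain ⟨F, hF⟩ := M.mem_domE_iff.1 hf
    obtain ⟨G, hG⟩ := M.mem_domE_iff.1 hg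
    exact M.mem_domE_iff.2 ⟨_, hF.add hG⟩
  zero_mem' := M.mem_domE_iff.2 ⟨fun _ => 0, by
    have := EnergyForm.Approx.const (B := M.energyForm) 0
    rwa [map_zero] at this⟩
  smul_mem' c f hf := by
    obtain ⟨F, hF⟩ := M.mem_domE_iff.1 hf
    exact M.mem_domE_iff.2 ⟨_, hF.smul c⟩

theorem toL2_mem_domE (F : M.A₀) : M.toL2 F ∈ M.domE :=
  M.mem_domE_iff.2 ⟨_, EnergyForm.Approx.const (B := M.energyForm) F⟩

variable {M}

theorem ΓExt_symm (hf : f ∈ M.domE) (hg : g ∈ M.domE) : M.ΓExt f g = M.ΓExt g f := by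
  obtain ⟨F, hF⟩ := M.mem_domE_iff.1 hf
  obtain ⟨G, hG⟩ := M.mem_domE_iff.1 hg
  exact tendsto_nhds_unique (tendsto_ΓExt_diag hF hG) ((tendsto_ΓExt_diag hG hF).congr
    fun n => M.energyForm.symm (G n) (F n))

theorem ΓExt_add_right (hf : f ∈ M.domE) (hg : g ∈ M.domE) (hg' : g' ∈ M.domE) :
    M.ΓExt f (g + g') = M.ΓExt f g + M.ΓExt f g' := by
  obtain ⟨F, hF⟩ := M.mem_domE_iff.1 hf
  obtain ⟨G, hG⟩ := M.mem_domE_iff.1 hg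
  obtain ⟨G', hG'⟩ := M.mem_domE_iff.1 hg'
  refine tendsto_nhds_unique (tendsto_ΓExt_diag hF (hG.add hG')) ?_
  simpa using (tendsto_ΓExt_diag hF hG).add (tendsto_ΓExt_diag hF hG')

theorem ΓExt_smul_right (c : ℝ) (hf : f ∈ M.domE) (hg : g ∈ M.domE) :
    M.ΓExt f (c • g) = c • M.ΓExt f g := by
  obtain ⟨F, hF⟩ := M.mem_domE_iff.1 hf
  obtain ⟨G, hG⟩ := M.mem_domE_iff.1 hg
  refine tendsto_nhds_unique (tendsto_ΓExt_diag hF (hG.smul c)) ?_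
  simpa using (tendsto_ΓExt_diag hF hG).const_smul c

theorem form_symm (hf : f ∈ M.domE) (hg : g ∈ M.domE) : M.form f g = M.form g f := by
  rw [form_eq, form_eq, ΓExt_symm hf hg]

theorem form_add_right (hf : f ∈ M.domE) (hg : g ∈ M.domE) (hg' : g' ∈ M.domE) :
    M.form f (g + g') = M.form f g + M.form f g' := by
  simp [form_eq, ΓExt_add_right hf hg hg']

theorem form_smul_right (c : ℝ) (hf : f ∈ M.domE) (hg : g ∈ M.domE) :
    M.form f (c • g) = c * M.form f g := by
  simp [form_eq, ΓExt_smul_right c hf hg]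

theorem dense_domESubmodule : Dense (M.domESubmodule : Set (Lp ℝ 2 μ)) := by
  intro f
  rw [EMetric.mem_closure_iff]
  intro ε hε
  obtain ⟨δ, hδ, hδε⟩ := exists_between hε
  obtain ⟨F, hF, h⟩ := M.A₀_dense 2 (by norm_num) (by norm_num) f δ hδ
  refine ⟨M.toL2 ⟨F, hF⟩, M.toL2_mem_domE _, ?_⟩
  rw [edist_comm, Lp.edist_def]
  refine (le_of_eq_of_le (eLpNorm_congr_ae ?_) h).trans_lt hδε
  filter_upwards [M.coeFn_toL2 ⟨F, hF⟩] with x hx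
  rw [Pi.sub_apply, hx]

/-- Membership in `D(L)` says that `-𝓔(f, ·)` is a functional on `D(𝓔)` bounded for the `L²` norm.
Hahn–Banach extends it to `L²` and Riesz represents it. -/
theorem LExt_spec (hf : f ∈ M.domL) {g : Lp ℝ 2 μ} (hg : g ∈ M.domE) :
    ∫ x, g x * M.LExt f x ∂μ = -M.form f g := by
  have ex : ∃ k : Lp ℝ 2 μ, ∀ g ∈ M.domE, ∫ x, g x * k x ∂μ = -M.form f g := by
    obtain ⟨hfE, c, hc⟩ := hf
    let φ : M.domESubmodule →ₗ[ℝ] ℝ :=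
      { toFun := fun g => -M.form f g
        map_add' := fun g g' => by
          rw [Submodule.coe_add, form_add_right hfE g.2 g'.2]; ring
        map_smul' := fun a g => by
          rw [Submodule.coe_smul, form_smul_right a hfE g.2]; simp }
    let φ' : StrongDual ℝ M.domESubmodule := φ.mkContinuous c fun g => by
      have := hc g g.2
      simpa [φ] using this
    obtain ⟨ψ, hψ, -⟩ := exists_extension_norm_eq M.domESubmodule φ'
    refine ⟨(InnerProductSpace.toDual ℝ (Lp ℝ 2 μ)).symm ψ, fun g hg => ?_⟩
    rw [integral_mul_eq_inner, InnerProductSpace.toDual_symm_apply]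
    exact hψ ⟨g, hg⟩
  rw [LExt, dif_pos ex]
  exact ex.choose_spec g hg

theorem LExt_eq (hf : f ∈ M.domL) {k : Lp ℝ 2 μ}
    (hk : ∀ g ∈ M.domE, ∫ x, g x * k x ∂μ = -M.form f g) : M.LExt f = k := by
  refine (dense_domESubmodule (M := M)).eq_of_inner_left (𝕜 := ℝ) fun g hg => ?_
  rw [← integral_mul_eq_inner, ← integral_mul_eq_inner, LExt_spec hf hg, hk g hg]

/-- Linearity of the generator, in the form needed to subtract a constant from a preimage under `L`.
-/
theorem add_smul_mem_domL (c : ℝ) (hf : f ∈ M.domL) (hf' : f' ∈ M.domL) :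
    f + c • f' ∈ M.domL ∧ M.LExt (f + c • f') = M.LExt f + c • M.LExt f' := by
  have hE : f + c • f' ∈ M.domE :=
    M.domESubmodule.add_mem hf.1 (M.domESubmodule.smul_mem c hf'.1)
  have hform : ∀ g ∈ M.domE, M.form (f + c • f') g = M.form f g + c * M.form f' g := by
    intro g hg
    rw [form_symm hE hg, form_add_right hg hf.1 (M.domESubmodule.smul_mem c hf'.1),
      form_smul_right c hg hf'.1, form_symm hg hf.1, form_symm hg hf'.1]
  have hL : f + c • f' ∈ M.domL := by
    refine ⟨hE, ?_⟩
    obtain ⟨-, a, ha⟩ := hf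
    obtain ⟨-, b, hb⟩ := hf'
    refine ⟨a + |c| * b, fun g hg => ?_⟩
    rw [hform g hg, add_mul, mul_assoc]
    refine (abs_add_le _ _).trans (add_le_add (ha g hg) ?_)
    rw [abs_mul]
    exact mul_le_mul_of_nonneg_left (hb g hg) (abs_nonneg c)
  refine ⟨hL, LExt_eq hL fun g hg => ?_⟩
  rw [hform g hg, integral_mul_eq_inner, inner_add_left, inner_smul_left,
    ← integral_mul_eq_inner, ← integral_mul_eq_inner, LExt_spec hf hg, LExt_spec hf' hg]
  simp; ring

end PreMarkovTriple

/-! ### The pseudo-inverse. -/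

namespace MarkovTriple

variable {E : Type*} [MeasurableSpace E] {μ : Measure E} [IsProbabilityMeasure μ]
  (M : MarkovTriple E μ)

/-- A preimage `U` of the centred variable can be replaced by `U - ∫ U dμ`, since `1 ∈ D(L)` and `L
1 = 0`. -/
theorem isPseudoInv_LInv {X : Lp ℝ 2 μ} (h : M.InvDefined X) : M.IsPseudoInv X (M.LInv X) := by
  have ex : ∃ U, M.IsPseudoInv X U := by
    obtain ⟨U, hU, hLU⟩ := h
    have hint : Integrable U μ := (Lp.memLp U).integrable (by norm_num)
    have h := PreMarkovTriple.add_smul_mem_domL (-∫ x, U x ∂μ) hU M.one_mem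
    refine ⟨_, h.1, ?_, by rw [h.2, hLU, M.L_one, smul_zero, add_zero]⟩
    have e : (U + (-∫ x, U x ∂μ) • Lp.const 2 μ (1 : ℝ) : Lp ℝ 2 μ) =ᵐ[μ]
        fun x => U x - ∫ x, U x ∂μ := by
      filter_upwards [Lp.coeFn_add U ((-∫ x, U x ∂μ) • Lp.const 2 μ (1 : ℝ)),
        Lp.coeFn_smul (-∫ x, U x ∂μ) (Lp.const 2 μ (1 : ℝ)), Lp.coeFn_const (p := 2) (μ := μ) (1 : ℝ)]
        with x h1 h2 h3
      rw [h1, Pi.add_apply, h2, Pi.smul_apply, h3]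
      simp [sub_eq_add_neg]
    rw [integral_congr_ae e, integral_sub hint (integrable_const _)]
    simp
  rw [LInv, dif_pos ex]
  exact ex.choose_spec

end MarkovTriple

/-! ### Chain rule and integration by parts on the Dirichlet domain, for smooth functions. -/

theorem EnergyForm.Approx.comp_strictMono {V H W : Type*} [AddCommGroup V] [Module ℝ V]
    [NormedAddCommGroup H] [NormedSpace ℝ H] [NormedAddCommGroup W] [NormedSpace ℝ W]
    {B : EnergyForm V H W} {F : ℕ → V} {f : H} (hF : B.Approx F f) {φ : ℕ → ℕ}
    (hφ : StrictMono φ) : B.Approx (fun n => F (φ n)) f :=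
  ⟨hF.1.comp hφ.tendsto_atTop, hF.2.comp
    ((hφ.tendsto_atTop.prodMap hφ.tendsto_atTop).mono_left prod_atTop_atTop_eq.ge
      |>.mono_right prod_atTop_atTop_eq.le)⟩

theorem tendsto_of_tendsto_prod {X : Type*} [PseudoMetricSpace X] {a : ℕ → ℕ → X} {b : ℕ → X}
    {c : X} (h : Tendsto (fun n : ℕ × ℕ => a n.1 n.2) atTop (𝓝 c))
    (hb : ∀ n, Tendsto (fun k => a k n) atTop (𝓝 (b n))) : Tendsto b atTop (𝓝 c) := by
  rw [Metric.tendsto_atTop] at h ⊢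
  intro ε hε
  obtain ⟨⟨k, n⟩, hN⟩ := h (ε / 2) (half_pos hε)
  refine ⟨n, fun m hm => ?_⟩
  have : dist (b m) c ≤ ε / 2 := by
    refine le_of_tendsto ((hb m).dist tendsto_const_nhds) ?_
    filter_upwards [eventually_ge_atTop k] with j hj
    exact (hN (j, m) ⟨hj, hm⟩).le
  linarith

section

variable {E : Type*} [MeasurableSpace E] {μ : Measure E}

/-- Write `bₙγₙ - b'γ' = bₙ(γₙ - γ') + (bₙ - b')γ'`: boundedness handles the first term, dominated
convergence the second. -/
theorem tendsto_integral_mul_of_bounded {b : ℕ → E → ℝ} {b' : E → ℝ} {C : ℝ}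
    {γ : ℕ → Lp ℝ 1 μ} {γ' : Lp ℝ 1 μ}
    (hbm : ∀ n, AEStronglyMeasurable (b n) μ) (hb : ∀ n x, |b n x| ≤ C)
    (hlim : ∀ᵐ x ∂μ, Tendsto (fun n => b n x) atTop (𝓝 (b' x)))
    (hγ : Tendsto γ atTop (𝓝 γ')) :
    Tendsto (fun n => ∫ x, b n x * γ n x ∂μ) atTop (𝓝 (∫ x, b' x * γ' x ∂μ)) := by
  have hi : ∀ f : Lp ℝ 1 μ, Integrable f μ := fun f => memLp_one_iff_integrable.1 (Lp.memLp f)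
  have hbi : ∀ n (f : Lp ℝ 1 μ), Integrable (fun x => b n x * f x) μ := fun n f =>
    (hi f).bdd_mul (hbm n) (Eventually.of_forall (hb n))
  have h1 : Tendsto (fun n => ∫ x, b n x * γ' x ∂μ) atTop (𝓝 (∫ x, b' x * γ' x ∂μ)) := by
    refine tendsto_integral_of_dominated_convergence (fun x => C * |γ' x|)
      (fun n => (hbi n γ').aestronglyMeasurable) ((hi γ').abs.const_mul C)
      (fun n => Eventually.of_forall fun x => ?_) ?_
    · rw [Real.norm_eq_abs, abs_mul]
      exact mul_le_mul_of_nonneg_right (hb n x) (abs_nonneg _)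
    · filter_upwards [hlim] with x hx using hx.mul_const _
  have h2 : Tendsto (fun n => ∫ x, b n x * γ n x ∂μ - ∫ x, b n x * γ' x ∂μ) atTop (𝓝 0) := by
    have hn : Tendsto (fun n => C * ‖γ n - γ'‖) atTop (𝓝 0) := by
      simpa using (tendsto_iff_norm_sub_tendsto_zero.1 hγ).const_mul C
    refine squeeze_zero_norm (fun n => ?_) hn
    rw [← integral_sub (hbi n _) (hbi n _), L1.norm_eq_integral_norm, ← integral_const_mul]
    refine norm_integral_le_of_norm_le ((hi _).norm.const_mul C) ?_
    filter_upwards [Lp.coeFn_sub (γ n) γ'] with x hx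
    rw [hx, Pi.sub_apply, ← mul_sub, norm_mul]
    exact mul_le_mul_of_nonneg_right (hb n x) (norm_nonneg _)
  simpa using h2.add h1

end

namespace PreMarkovTriple

variable {E : Type*} [MeasurableSpace E] {μ : Measure E} (M : PreMarkovTriple E μ)

/-- The composition of a smooth function vanishing at `0` with an element of `A₀`. -/
theorem exists_comp {ψ : ℝ → ℝ} (hψ : ContDiff ℝ ((⊤ : ℕ∞) : WithTop ℕ∞) ψ) (h0 : ψ 0 = 0)
    (F : M.A₀) : ∃ Φ : M.A₀, (∀ x, ((Φ : M.A) : E → ℝ) x = ψ (((F : M.A) : E → ℝ) x)) ∧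
      ∀ G : M.A, ∀ᵐ x ∂μ, (M.Γ G Φ : E → ℝ) x =
        deriv ψ (((F : M.A) : E → ℝ) x) * (M.Γ G F : E → ℝ) x := by
  have hc : ContDiff ℝ ((⊤ : ℕ∞) : WithTop ℕ∞) (fun y : Fin 1 → ℝ => ψ (y 0)) :=
    hψ.comp (contDiff_apply ℝ ℝ 0)
  have hA := M.A_smooth 1 _ hc (fun _ => F)
  refine ⟨⟨⟨_, hA⟩, M.A₀_smooth 1 _ hc (by simpa using h0) (fun _ => F) (fun _ => F.2) _
    fun _ => rfl⟩, fun _ => rfl, fun G => ?_⟩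
  filter_upwards [M.diffusion_Γ 1 _ hc (fun _ => F) G ⟨_, hA⟩ fun _ => rfl,
    M.Γ_symm G ⟨_, hA⟩, M.Γ_symm G F] with x h1 h2 h3
  rw [h2, h1, h3]
  have hd : DifferentiableAt ℝ ψ (((F : M.A) : E → ℝ) x) :=
    hψ.contDiffAt.differentiableAt (by simp)
  have : pderiv (0 : Fin 1) (fun y : Fin 1 → ℝ => ψ (y 0))
      (fun _ => ((F : M.A) : E → ℝ) x) = deriv ψ (((F : M.A) : E → ℝ) x) := by
    have hp : HasFDerivAt (fun y : Fin 1 → ℝ => y 0)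
        (ContinuousLinearMap.proj (R := ℝ) (φ := fun _ : Fin 1 => ℝ) 0)
        (fun _ => ((F : M.A) : E → ℝ) x) := hasFDerivAt_apply 0 _
    have h := HasDerivAt.comp_hasFDerivAt (fun _ => ((F : M.A) : E → ℝ) x) hd.hasDerivAt hp
    rw [pderiv]
    erw [h.fderiv]
    simp
  simp [this]

variable [IsFiniteMeasure μ] {M} {U G : Lp ℝ 2 μ} {ψ : ℝ → ℝ} {C : ℝ}

/-- Test the definition of `L U` against `ψ(F) ∈ A₀`. The identity `Γ(V, ψ(F)) = ψ'(F) Γ(V, F)`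
holds for `V ∈ A₀` by diffusion and passes to `U` along an approximating sequence, as `ψ'` is
bounded. -/
theorem integral_comp_mul_LExt_of_mem_A₀ (hU : U ∈ M.domL)
    (hψ : ContDiff ℝ ((⊤ : ℕ∞) : WithTop ℕ∞) ψ) (h0 : ψ 0 = 0) (hC : ∀ x, |deriv ψ x| ≤ C)
    (F : M.A₀) :
    ∫ x, ψ (((F : M.A) : E → ℝ) x) * M.LExt U x ∂μ =
      -∫ x, deriv ψ (((F : M.A) : E → ℝ) x) * M.ΓExt U (M.toL2 F) x ∂μ := by
  obtain ⟨Φ, hΦ, hΓ⟩ := M.exists_comp hψ h0 F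
  obtain ⟨V, hV⟩ := M.mem_domE_iff.1 hU.1
  have h1 := LExt_spec hU (M.toL2_mem_domE Φ)
  have h2 : ∫ x, ψ (((F : M.A) : E → ℝ) x) * M.LExt U x ∂μ =
      ∫ x, M.toL2 Φ x * M.LExt U x ∂μ := by
    refine integral_congr_ae ?_
    filter_upwards [M.coeFn_toL2 Φ] with x hx
    rw [hx, hΦ]
  rw [h2, h1, form_eq]
  congr 1
  have l1 := (L1.integralCLM.continuous.tendsto _).comp
    (tendsto_ΓExt_diag hV (EnergyForm.Approx.const (B := M.energyForm) Φ))
  have hm : Measurable fun x => deriv ψ (((F : M.A) : E → ℝ) x) :=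
    (measurable_deriv ψ).comp (M.A_measurable _ (F : M.A).2)
  have l2 := tendsto_integral_mul_of_bounded (C := C)
    (b := fun _ x => deriv ψ (((F : M.A) : E → ℝ) x)) (fun _ => hm.aestronglyMeasurable)
    (fun _ x => hC _) (Eventually.of_forall fun x => tendsto_const_nhds)
    (tendsto_ΓExt_diag hV (EnergyForm.Approx.const (B := M.energyForm) F))
  refine tendsto_nhds_unique l1 (l2.congr fun n => ?_)
  rw [Function.comp_apply, integralCLM_ΓL1]
  refine integral_congr_ae ?_
  filter_upwards [hΓ (V n), M.coeFn_ΓL1 (V n) F] with x h3 h4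
  rw [h3, h4]

/-- Approximate `G` by `Fₙ ∈ A₀`, converging almost surely after extraction. Then `ψ(Fₙ) → ψ(G)` in
`L²` as `ψ` is Lipschitz, `ψ'(Fₙ) → ψ'(G)` boundedly almost surely, and `Γ(U, Fₙ) → Γ(U, G)` in
`L¹`. -/
theorem integral_comp_mul_LExt (hU : U ∈ M.domL) (hG : G ∈ M.domE)
    (hψ : ContDiff ℝ ((⊤ : ℕ∞) : WithTop ℕ∞) ψ) (h0 : ψ 0 = 0) (hC : ∀ x, |deriv ψ x| ≤ C) :
    ∫ x, ψ (G x) * M.LExt U x ∂μ = -∫ x, deriv ψ (G x) * M.ΓExt U G x ∂μ := by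
  obtain ⟨V, hV⟩ := M.mem_domE_iff.1 hU.1
  obtain ⟨F₀, hF₀⟩ := M.mem_domE_iff.1 hG
  have hae : ∃ ns : ℕ → ℕ, StrictMono ns ∧ ∀ᵐ x ∂μ, Tendsto (fun i =>
      M.toL2 (F₀ (ns i)) x) atTop (𝓝 (G x)) :=
    (tendstoInMeasure_of_tendsto_Lp hF₀.1).exists_seq_tendsto_ae
  obtain ⟨ns, hns, hae⟩ := hae
  have hF := hF₀.comp_strictMono hns
  set F := fun n => F₀ (ns n) with hFdef
  have hlip : LipschitzWith C.toNNReal ψ := by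
    refine lipschitzWith_of_nnnorm_deriv_le (hψ.differentiable (by simp)) fun x => ?_
    rw [← NNReal.coe_le_coe, coe_nnnorm, Real.norm_eq_abs]
    exact (hC x).trans (Real.le_coe_toNNReal C)
  have l1 : Tendsto (fun n => ∫ x, ψ (((F n : M.A) : E → ℝ) x) * M.LExt U x ∂μ) atTop
      (𝓝 (∫ x, ψ (G x) * M.LExt U x ∂μ)) := by
    have h := ((hlip.continuous_compLp (p := 2) (μ := μ) h0).tendsto G).comp hF.1
    have h' := h.inner (𝕜 := ℝ) (tendsto_const_nhds (x := M.LExt U))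
    have e : ∀ f : Lp ℝ 2 μ, inner ℝ (hlip.compLp h0 f) (M.LExt U) =
        ∫ x, ψ (f x) * M.LExt U x ∂μ := by
      intro f
      rw [real_inner_comm, ← integral_mul_eq_inner]
      refine integral_congr_ae ?_
      filter_upwards [hlip.coeFn_compLp h0 f] with x hx
      rw [hx]; rfl
    rw [e] at h'
    refine h'.congr fun n => ?_
    rw [Function.comp_apply, e]
    refine integral_congr_ae ?_
    filter_upwards [M.coeFn_toL2 (F n)] with x hx
    rw [← hx]; rfl
  -- Iterated limit: for fixed `n`, let the approximation of `U` converge first inside the joint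
  -- limit.
  have l2 : Tendsto (fun n => M.ΓExt U (M.toL2 (F n))) atTop (𝓝 (M.ΓExt U G)) :=
    tendsto_of_tendsto_prod (tendsto_ΓExt hV hF) fun n =>
      tendsto_ΓExt_diag hV (EnergyForm.Approx.const (B := M.energyForm) (F n))
  have hcont : Continuous (deriv ψ) := hψ.continuous_deriv (by simp)
  have l3 := tendsto_integral_mul_of_bounded (C := C)
    (b := fun n x => deriv ψ (((F n : M.A) : E → ℝ) x)) (b' := fun x => deriv ψ (G x))
    (fun n => ((measurable_deriv ψ).comp
      (M.A_measurable _ (F n : M.A).2)).aestronglyMeasurable)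
    (fun _ x => hC _) (by
      have := ae_all_iff.2 fun n => M.coeFn_toL2 (F n)
      filter_upwards [hae, this] with x hx h
      exact (hcont.tendsto _).comp (hx.congr fun n => h n)) l2
  refine tendsto_nhds_unique l1 ?_
  simp only [integral_comp_mul_LExt_of_mem_A₀ hU hψ h0 hC]
  exact l3.neg

end PreMarkovTriple

/-! ### From smooth functions to primitives of bounded measurable functions. -/

section

variable {E : Type*} [MeasurableSpace E] {μ : Measure E}

/-- The identity `∫ (∫₀ˣ φ) k dμ = -∫ φ(X) γ dμ` for a bounded measurable `φ`. -/
def PrimitiveIdentity (μ : Measure E) (X k γ : E → ℝ) (φ : ℝ → ℝ) : Prop :=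
  Measurable φ ∧ (∃ C, ∀ t, |φ t| ≤ C) ∧
    ∫ x, (∫ t in (0 : ℝ)..X x, φ t) * k x ∂μ = -∫ x, φ (X x) * γ x ∂μ

theorem intervalIntegrable_of_bounded {φ : ℝ → ℝ} (hm : Measurable φ) {C : ℝ}
    (hC : ∀ t, |φ t| ≤ C) (a b : ℝ) : IntervalIntegrable φ volume a b := by
  refine (intervalIntegrable_const (c := C)).mono_fun hm.aestronglyMeasurable
    (Eventually.of_forall fun t => ?_)
  exact (hC t).trans (le_abs_self C)

theorem abs_primitive_le {φ : ℝ → ℝ} {C : ℝ} (hC : ∀ t, |φ t| ≤ C) (y : ℝ) :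
    |∫ t in (0 : ℝ)..y, φ t| ≤ C * |y| := by
  simpa using intervalIntegral.norm_integral_le_of_norm_le_const (a := 0) (b := y) (f := φ)
    (C := C) fun t _ => hC t

theorem measurable_primitive {φ : ℝ → ℝ} (hm : Measurable φ) {C : ℝ} (hC : ∀ t, |φ t| ≤ C) :
    Measurable fun y => ∫ t in (0 : ℝ)..y, φ t :=
  (intervalIntegral.continuous_primitive (intervalIntegrable_of_bounded hm hC) 0).measurable

variable {X k γ : E → ℝ} {φ φ' : ℝ → ℝ}

theorem integrable_primitive_mul (hX : Measurable X) (hk : AEStronglyMeasurable k μ)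
    (hXk : Integrable (fun x => X x * k x) μ) (hm : Measurable φ) {C : ℝ}
    (hC : ∀ t, |φ t| ≤ C) : Integrable (fun x => (∫ t in (0 : ℝ)..X x, φ t) * k x) μ := by
  refine (hXk.const_mul C).mono
    (((measurable_primitive hm hC).comp hX).aestronglyMeasurable.mul hk)
    (Eventually.of_forall fun x => ?_)
  have h0 : 0 ≤ C := (abs_nonneg _).trans (hC 0)
  rw [norm_mul, norm_mul, norm_mul, Real.norm_eq_abs, Real.norm_eq_abs C, abs_of_nonneg h0,
    ← mul_assoc]
  exact mul_le_mul_of_nonneg_right (abs_primitive_le hC _) (norm_nonneg _)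

theorem integrable_comp_mul (hX : Measurable X) (hγ : Integrable γ μ) (hm : Measurable φ) {C : ℝ}
    (hC : ∀ t, |φ t| ≤ C) : Integrable (fun x => φ (X x) * γ x) μ :=
  hγ.bdd_mul (hm.comp hX).aestronglyMeasurable (Eventually.of_forall fun _ => hC _)

theorem PrimitiveIdentity.add (hX : Measurable X) (hk : AEStronglyMeasurable k μ)
    (hXk : Integrable (fun x => X x * k x) μ) (hγ : Integrable γ μ)
    (h : PrimitiveIdentity μ X k γ φ) (h' : PrimitiveIdentity μ X k γ φ') :
    PrimitiveIdentity μ X k γ (fun t => φ t + φ' t) := by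
  obtain ⟨hm, ⟨C, hC⟩, h⟩ := h
  obtain ⟨hm', ⟨C', hC'⟩, h'⟩ := h'
  refine ⟨hm.add hm', ⟨C + C', fun t => (abs_add_le _ _).trans (add_le_add (hC t) (hC' t))⟩, ?_⟩
  simp_rw [intervalIntegral.integral_add (intervalIntegrable_of_bounded hm hC _ _)
    (intervalIntegrable_of_bounded hm' hC' _ _), add_mul]
  rw [integral_add (integrable_primitive_mul hX hk hXk hm hC)
    (integrable_primitive_mul hX hk hXk hm' hC'),
    integral_add (integrable_comp_mul hX hγ hm hC) (integrable_comp_mul hX hγ hm' hC'), h, h']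
  ring

theorem PrimitiveIdentity.const_mul (h : PrimitiveIdentity μ X k γ φ) (c : ℝ) :
    PrimitiveIdentity μ X k γ (fun t => c * φ t) := by
  obtain ⟨hm, ⟨C, hC⟩, h⟩ := h
  refine ⟨hm.const_mul c, ⟨|c| * C, fun t => ?_⟩, ?_⟩
  · rw [abs_mul]; exact mul_le_mul_of_nonneg_left (hC t) (abs_nonneg c)
  · simp_rw [intervalIntegral.integral_const_mul, mul_assoc]
    rw [integral_const_mul, integral_const_mul, h, mul_neg]

/-- The identity is stable under bounded pointwise limits: `|∫₀ˣ φₙ| ≤ C|x|`, so both sides are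
dominated, by `C|Xk|` and `C|γ|`. -/
theorem PrimitiveIdentity.of_tendsto (hX : Measurable X) (hk : AEStronglyMeasurable k μ)
    (hXk : Integrable (fun x => X x * k x) μ) (hγ : Integrable γ μ) {φs : ℕ → ℝ → ℝ} {C : ℝ}
    (h : ∀ n, PrimitiveIdentity μ X k γ (φs n)) (hC : ∀ n t, |φs n t| ≤ C)
    (hlim : ∀ t, Tendsto (fun n => φs n t) atTop (𝓝 (φ t))) : PrimitiveIdentity μ X k γ φ := by
  have h0 : 0 ≤ C := (abs_nonneg _).trans (hC 0 0)
  refine ⟨measurable_of_tendsto_metrizable (fun n => (h n).1) (tendsto_pi_nhds.2 hlim),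
    ⟨C, fun t => le_of_tendsto (hlim t).abs (Eventually.of_forall fun n => hC n t)⟩, ?_⟩
  have l1 : Tendsto (fun n => ∫ x, (∫ t in (0 : ℝ)..X x, φs n t) * k x ∂μ) atTop
      (𝓝 (∫ x, (∫ t in (0 : ℝ)..X x, φ t) * k x ∂μ)) := by
    refine tendsto_integral_of_dominated_convergence (fun x => C * |X x * k x|)
      (fun n => (integrable_primitive_mul hX hk hXk (h n).1 (hC n)).aestronglyMeasurable)
      (hXk.abs.const_mul C) (fun n => Eventually.of_forall fun x => ?_)
      (Eventually.of_forall fun x => Tendsto.mul_const _ ?_)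
    · rw [norm_mul, abs_mul, ← mul_assoc]
      exact mul_le_mul_of_nonneg_right (abs_primitive_le (hC n) _) (abs_nonneg _)
    · exact intervalIntegral.tendsto_integral_filter_of_dominated_convergence (fun _ => C)
        (Eventually.of_forall fun n => (h n).1.aestronglyMeasurable)
        (Eventually.of_forall fun n => Eventually.of_forall fun t _ => hC n t)
        intervalIntegrable_const (Eventually.of_forall fun t _ => hlim t)
  have l2 : Tendsto (fun n => ∫ x, φs n (X x) * γ x ∂μ) atTop (𝓝 (∫ x, φ (X x) * γ x ∂μ)) := by
    refine tendsto_integral_of_dominated_convergence (fun x => C * |γ x|)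
      (fun n => (integrable_comp_mul hX hγ (h n).1 (hC n)).aestronglyMeasurable)
      (hγ.abs.const_mul C) (fun n => Eventually.of_forall fun x => ?_)
      (Eventually.of_forall fun x => (hlim _).mul_const _)
    rw [norm_mul]
    exact mul_le_mul_of_nonneg_right (hC n _) (norm_nonneg _)
  exact tendsto_nhds_unique l1 (l2.neg.congr fun n => (h n).2.2.symm)

theorem primitiveIdentity_of_contDiff
    (hs : ∀ ψ : ℝ → ℝ, ContDiff ℝ ((⊤ : ℕ∞) : WithTop ℕ∞) ψ → ψ 0 = 0 →
      (∃ C, ∀ t, |deriv ψ t| ≤ C) → ∫ x, ψ (X x) * k x ∂μ = -∫ x, deriv ψ (X x) * γ x ∂μ)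
    (hφ : ContDiff ℝ ((⊤ : ℕ∞) : WithTop ℕ∞) φ) (hC : ∃ C, ∀ t, |φ t| ≤ C) :
    PrimitiveIdentity μ X k γ φ := by
  have hd : ∀ y, HasDerivAt (fun y => ∫ t in (0 : ℝ)..y, φ t) (φ y) y := fun y =>
    hφ.continuous.integral_hasStrictDerivAt 0 y |>.hasDerivAt
  have hd' : deriv (fun y => ∫ t in (0 : ℝ)..y, φ t) = φ := funext fun y => (hd y).deriv
  refine ⟨hφ.continuous.measurable, hC, ?_⟩
  have := hs (fun y => ∫ t in (0 : ℝ)..y, φ t)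
    (contDiff_infty_iff_deriv.2 ⟨fun y => (hd y).differentiableAt, by rwa [hd']⟩) (by simp)
    (by rwa [hd'])
  rwa [hd'] at this

/-- The identity extends from smooth functions to all bounded measurable functions. -/
theorem primitiveIdentity_of_measurable (hX : Measurable X) (hk : AEStronglyMeasurable k μ)
    (hXk : Integrable (fun x => X x * k x) μ) (hγ : Integrable γ μ)
    (hs : ∀ ψ : ℝ → ℝ, ContDiff ℝ ((⊤ : ℕ∞) : WithTop ℕ∞) ψ → ψ 0 = 0 →
      (∃ C, ∀ t, |deriv ψ t| ≤ C) → ∫ x, ψ (X x) * k x ∂μ = -∫ x, deriv ψ (X x) * γ x ∂μ)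
    (hφ : Measurable φ) {C : ℝ} (hC : ∀ t, |φ t| ≤ C) : PrimitiveIdentity μ X k γ φ := by
  have h1 : PrimitiveIdentity μ X k γ (fun _ => 1) :=
    primitiveIdentity_of_contDiff hs contDiff_const ⟨1, by simp⟩
  -- Indicators of Borel sets, by the π-λ theorem starting from the half-lines `(a, ∞)`.
  have hind : ∀ s : Set ℝ, MeasurableSet s →
      PrimitiveIdentity μ X k γ (s.indicator fun _ => 1) := by
    intro s hs'
    induction s, hs' using MeasurableSpace.induction_on_inter
      (borel_eq_generateFrom_Ioi ℝ ▸ BorelSpace.measurable_eq) isPiSystem_Ioi with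
    | empty => simpa using h1.const_mul 0
    | basic t ht =>
      obtain ⟨a, rfl⟩ := ht
      -- The indicator of `(a, ∞)` is the bounded limit of smooth steps, equal to `0` on `t ≤ a` and
      -- to `1` as soon as `n (t - a) ≥ 1`.
      refine PrimitiveIdentity.of_tendsto hX hk hXk hγ (C := 1)
        (φs := fun n t => Real.smoothTransition (n * (t - a))) (fun n => ?_) (fun n t => ?_)
        fun t => ?_
      · refine primitiveIdentity_of_contDiff hs
          (Real.smoothTransition.contDiff.comp
            (contDiff_const.mul (contDiff_id.sub contDiff_const))) ⟨1, fun t => ?_⟩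
        rw [abs_of_nonneg (Real.smoothTransition.nonneg _)]
        exact Real.smoothTransition.le_one _
      · rw [abs_of_nonneg (Real.smoothTransition.nonneg _)]
        exact Real.smoothTransition.le_one _
      · rcases le_or_gt t a with h | h
        · rw [Set.indicator_of_notMem (by simpa using h)]
          refine tendsto_const_nhds.congr fun n => ?_
          rw [Real.smoothTransition.zero_of_nonpos]
          exact mul_nonpos_of_nonneg_of_nonpos n.cast_nonneg (by linarith)
        · rw [Set.indicator_of_mem (by simpa using h)]
          refine tendsto_const_nhds.congr' ?_
          obtain ⟨N, hN⟩ := exists_nat_gt (1 / (t - a))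
          filter_upwards [eventually_ge_atTop N] with n hn
          rw [Real.smoothTransition.one_of_one_le]
          have h2 : 1 / (t - a) ≤ n := hN.le.trans (by exact_mod_cast hn)
          rwa [div_le_iff₀ (by linarith)] at h2
    | compl t ht ih =>
      have := h1.add hX hk hXk hγ (ih.const_mul (-1))
      refine (congrArg _ (funext fun x => ?_)).mp this
      by_cases hx : x ∈ t <;> simp [hx]
    | iUnion f hd hm ih =>
      have hfin : ∀ n : ℕ, PrimitiveIdentity μ X k γ
          ((⋃ i ∈ Finset.range n, f i).indicator fun _ => 1) := by
        intro n
        induction n with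
        | zero => simpa using h1.const_mul 0
        | succ n hn =>
          have := hn.add hX hk hXk hγ (ih n)
          refine (congrArg _ (funext fun x => ?_)).mp this
          rw [Finset.range_add_one, Finset.set_biUnion_insert, Set.union_comm,
            Set.indicator_union_of_disjoint]
          rw [Set.disjoint_iUnion₂_left]
          intro i hi
          exact hd (Finset.mem_range.1 hi).ne
      refine PrimitiveIdentity.of_tendsto hX hk hXk hγ (C := 1) hfin (fun n t => ?_) fun t => ?_
      · by_cases h : t ∈ ⋃ i ∈ Finset.range n, f i <;> simp only [h, not_false_eq_true,
          Set.indicator_of_mem, Set.indicator_of_notMem] <;> norm_num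
      · by_cases h : t ∈ ⋃ i, f i
        · rw [Set.indicator_of_mem h]
          obtain ⟨i, hi⟩ := Set.mem_iUnion.1 h
          refine tendsto_const_nhds.congr' ?_
          filter_upwards [eventually_gt_atTop i] with n hn
          have hmem : t ∈ ⋃ i ∈ Finset.range n, f i := by
            simp only [Set.mem_iUnion]
            exact ⟨i, Finset.mem_range.2 hn, hi⟩
          exact (Set.indicator_of_mem hmem fun _ => (1 : ℝ)).symm
        · rw [Set.indicator_of_notMem h]
          refine tendsto_const_nhds.congr fun n => ?_
          rw [Set.indicator_of_notMem]
          exact fun h' => h (Set.iUnion₂_subset_iUnion _ _ h')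
  have hsimple : ∀ f : SimpleFunc ℝ ℝ, PrimitiveIdentity μ X k γ f := by
    intro f
    induction f using SimpleFunc.induction with
    | @const c s hs' =>
      refine (congrArg _ (funext fun x => ?_)).mp ((hind _ hs').const_mul c)
      by_cases hx : x ∈ s <;> simp [hx]
    | add _ hf hg => exact hf.add hX hk hXk hγ hg
  have hφ' := hφ.stronglyMeasurable
  -- A bounded measurable function is a pointwise limit of simple functions with the same bound.
  exact PrimitiveIdentity.of_tendsto hX hk hXk hγ (fun n => hsimple (hφ'.approxBounded C n))
    (fun n t => hφ'.norm_approxBounded_le ((abs_nonneg _).trans (hC 0)) n t)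
    fun t => hφ'.tendsto_approxBounded_of_norm_le (hC t)

end

namespace PreMarkovTriple

variable {E : Type*} [MeasurableSpace E] {μ : Measure E} [IsFiniteMeasure μ]
  {M : PreMarkovTriple E μ} {U G : Lp ℝ 2 μ}

/-- Integration by parts and the chain rule for a Lipschitz function with a prescribed version
`φ` of the derivative. -/
theorem integral_primitive_mul_LExt (hU : U ∈ M.domL) (hG : G ∈ M.domE) {φ : ℝ → ℝ}
    (hφ : Measurable φ) {C : ℝ} (hC : ∀ t, |φ t| ≤ C) :
    ∫ x, (∫ t in (0 : ℝ)..G x, φ t) * M.LExt U x ∂μ = -∫ x, φ (G x) * M.ΓExt U G x ∂μ := by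
  refine (primitiveIdentity_of_measurable (Lp.stronglyMeasurable G).measurable
    (Lp.stronglyMeasurable _).aestronglyMeasurable ?_
    (memLp_one_iff_integrable.1 (Lp.memLp (M.ΓExt U G))) (fun ψ hψ h0 ⟨C, hC⟩ => ?_) hφ hC).2.2
  · exact (Lp.memLp G).integrable_mul (Lp.memLp (M.LExt U))
  · exact integral_comp_mul_LExt hU hG hψ h0 hC

end PreMarkovTriple

/-! ### Absolutely continuous functions -/

/-- The map `y ↦ y⁻¹` is Lipschitz with constant `1 / δ²` on `[δ, ∞)`. -/
theorem absolutelyContinuousOnInterval_inv {f : ℝ → ℝ} {a b δ : ℝ}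
    (hf : AbsolutelyContinuousOnInterval f a b) (hδ : 0 < δ) (h : ∀ x ∈ Set.uIcc a b, δ ≤ f x) :
    AbsolutelyContinuousOnInterval (fun x => (f x)⁻¹) a b := by
  have hl : LipschitzOnWith (Real.toNNReal (1 / δ ^ 2)) (fun y : ℝ => y⁻¹) (Set.Ici δ) := by
    refine LipschitzOnWith.of_dist_le_mul fun x hx y hy => ?_
    have hx0 : 0 < x := hδ.trans_le hx
    have hy0 : 0 < y := hδ.trans_le hy
    rw [Real.coe_toNNReal _ (by positivity), Real.dist_eq, Real.dist_eq,
      inv_sub_inv hx0.ne' hy0.ne', abs_div, abs_of_pos (mul_pos hx0 hy0), abs_sub_comm,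
      div_mul_eq_mul_div, one_mul]
    gcongr
    nlinarith [Set.mem_Ici.1 hx, Set.mem_Ici.1 hy]
  rw [absolutelyContinuousOnInterval_iff] at hf ⊢
  intro ε hε
  obtain ⟨η, hη, H⟩ := hf (ε * δ ^ 2) (by positivity)
  refine ⟨η, hη, fun I hI hI' => ?_⟩
  have h1 := H I hI hI'
  have h2 : ∑ i ∈ Finset.range I.1, dist (f (I.2 i).1)⁻¹ (f (I.2 i).2)⁻¹ ≤
      1 / δ ^ 2 * ∑ i ∈ Finset.range I.1, dist (f (I.2 i).1) (f (I.2 i).2) := by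
    rw [Finset.mul_sum]
    refine Finset.sum_le_sum fun i hi => ?_
    have hm := hI.1 i hi
    have := hl.dist_le_mul _ (h _ hm.1) _ (h _ hm.2)
    rwa [Real.coe_toNNReal _ (by positivity)] at this
  refine h2.trans_lt ?_
  rw [one_div, inv_mul_lt_iff₀ (by positivity), mul_comm]
  exact h1

/-- Since `p` is only measurable, tail integrals are differentiable only almost everywhere;
monotonicity therefore goes through absolute continuity. -/
theorem le_of_deriv_nonpos {f f' : ℝ → ℝ} {a b : ℝ}
    (hf : AbsolutelyContinuousOnInterval f a b) (hab : a ≤ b)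
    (hd : ∀ᵐ x, x ∈ Set.Icc a b → HasDerivAt f (f' x) x ∧ f' x ≤ 0) : f b ≤ f a := by
  have h := hf.integral_deriv_eq_sub
  have h2 : ∫ x in a..b, deriv f x ≤ ∫ x in a..b, (0 : ℝ) := by
    refine intervalIntegral.integral_mono_ae_restrict hab hf.intervalIntegrable_deriv
      intervalIntegrable_const ?_
    refine (ae_restrict_iff' measurableSet_Icc).2 ?_
    filter_upwards [hd] with x hx hx'
    rw [(hx hx').1.deriv]
    exact (hx hx').2
  rw [h, intervalIntegral.integral_zero] at h2
  linarith

theorem abs_sub_le_of_abs_deriv_le {f : ℝ → ℝ} {a b C : ℝ}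
    (hf : AbsolutelyContinuousOnInterval f a b)
    (hd : ∀ᵐ x, x ∈ Set.uIcc a b → |deriv f x| ≤ C) : |f b - f a| ≤ C * |b - a| := by
  rw [← hf.integral_deriv_eq_sub]
  refine intervalIntegral.norm_integral_le_of_norm_le_const_ae (f := deriv f) ?_
  filter_upwards [hd] with x hx hx' using hx (Set.uIoc_subset_uIcc hx')

/-! ### Tail integrals -/

section Tail

variable {f : ℝ → ℝ} (hf : Integrable f)

include hf

theorem tail_eq (a x : ℝ) : ∫ y in Set.Ioi x, f y =
    (∫ y in Set.Ioi a, f y) - ∫ y in a..x, f y := by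
  have := intervalIntegral.integral_interval_add_Ioi (a := a) (b := x) hf.integrableOn
    hf.integrableOn
  linarith

theorem absolutelyContinuousOnInterval_tail (a b : ℝ) :
    AbsolutelyContinuousOnInterval (fun x => ∫ y in Set.Ioi x, f y) a b := by
  have h := (IntervalIntegrable.absolutelyContinuousOnInterval_intervalIntegral
    (hf.intervalIntegrable (a := a) (b := b)) (c := a) Set.left_mem_uIcc)
  have hc : AbsolutelyContinuousOnInterval (fun _ : ℝ => ∫ y in Set.Ioi a, f y) a b :=
    (contDiffOn_const).absolutelyContinuousOnInterval
  refine (congrArg (fun F => AbsolutelyContinuousOnInterval F a b) (funext fun x => ?_)).mp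
    (hc.fun_sub h)
  exact (tail_eq hf a x).symm

theorem continuous_tail : Continuous fun x => ∫ y in Set.Ioi x, f y := by
  rw [funext fun x => tail_eq hf 0 x]
  exact continuous_const.sub (intervalIntegral.continuous_primitive
    (fun _ _ => hf.intervalIntegrable) 0)

theorem ae_hasDerivAt_tail : ∀ᵐ x, HasDerivAt (fun x => ∫ y in Set.Ioi x, f y) (-f x) x := by
  filter_upwards [LocallyIntegrable.ae_hasDerivAt_integral hf.locallyIntegrable] with x hx
  rw [funext fun x => tail_eq hf 0 x]
  exact (hx 0).const_sub _

end Tail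

/-! ### The endpoints of an interval -/

theorem exists_real_of_eventually_toRight {u : EReal} {m : ℝ} (hm : (m : EReal) < u) {P : ℝ → Prop}
    (h : ∀ᶠ x in toRight u, P x) :
    ∃ x₀ : ℝ, m < x₀ ∧ (x₀ : EReal) < u ∧ ∀ x : ℝ, x₀ ≤ x → (x : EReal) < u → P x := by
  rw [toRight, eventually_comap] at h
  obtain ⟨e, he, hs⟩ := (mem_nhdsLT_iff_exists_mem_Ico_Ioo_subset hm).1 h
  obtain ⟨x₀, h1, h2⟩ := EReal.lt_iff_exists_real_btwn.1 he.2
  refine ⟨x₀, EReal.coe_lt_coe_iff.1 (he.1.trans_lt h1), h2, fun x hx hxu => ?_⟩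
  exact hs ⟨h1.trans_le (EReal.coe_le_coe_iff.2 hx), hxu⟩ x rfl

theorem eventually_toRight {u : EReal} {m : ℝ} (hm : (m : EReal) < u) :
    ∀ᶠ x in toRight u, m < x ∧ (x : EReal) < u := by
  rw [toRight, eventually_comap]
  filter_upwards [Ioo_mem_nhdsLT hm] with y hy x hx
  subst hx
  exact ⟨EReal.coe_lt_coe_iff.1 hy.1, hy.2⟩

theorem toRight_neBot {u : EReal} {m : ℝ} (hm : (m : EReal) < u) : (toRight u).NeBot := by
  rw [neBot_iff]
  intro h
  obtain ⟨x₀, -, h2, h3⟩ := exists_real_of_eventually_toRight hm (P := fun _ => False)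
    (by rw [h]; exact eventually_bot)
  obtain ⟨x, h4, h5⟩ := EReal.lt_iff_exists_real_btwn.1 h2
  exact h3 x (EReal.coe_lt_coe_iff.1 h4).le h5

/-- Dominated convergence; when `u` is finite, the part of the integral beyond `u` vanishes. -/
theorem tendsto_tail_toRight {f : ℝ → ℝ} (hf : Integrable f) {u : EReal}
    (h0 : ∀ x : ℝ, u ≤ x → f x = 0) :
    Tendsto (fun x => ∫ y in Set.Ioi x, f y) (toRight u) (𝓝 0) := by
  have : (toRight u).IsCountablyGenerated := by unfold toRight; infer_instance
  have e : ∀ x, ∫ y in Set.Ioi x, f y = ∫ y, (Set.Ioi x).indicator f y := fun x =>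
    (integral_indicator measurableSet_Ioi).symm
  simp_rw [e]
  rw [← integral_zero ℝ ℝ]
  refine tendsto_integral_filter_of_dominated_convergence (fun y => ‖f y‖)
    (Eventually.of_forall fun x => hf.aestronglyMeasurable.indicator measurableSet_Ioi)
    (Eventually.of_forall fun x => Eventually.of_forall fun y => norm_indicator_le_norm_self f y)
    hf.norm (Eventually.of_forall fun y => ?_)
  refine tendsto_const_nhds.congr' ?_
  rcases lt_or_ge (y : EReal) u with h | h
  · filter_upwards [eventually_toRight h] with x hx
    rw [Set.indicator_of_notMem]
    simpa using hx.1.le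
  · filter_upwards with x
    rw [Set.indicator_apply, h0 y h, ite_self]

/-! ### The second tail integral at an endpoint -/

section Endpoint

variable {p a g : ℝ → ℝ} {u : EReal} {m x₀ c C : ℝ}

theorem integrable_sub_mul (hp : Integrable p) (hp1 : Integrable fun y => y * p y) (x : ℝ) :
    Integrable fun y => (y - x) * p y := by
  simp only [sub_mul]
  exact hp1.sub (hp.const_mul x)

theorem tail_sub_le (hp0 : ∀ y, 0 ≤ p y) (hp : Integrable p) (hp1 : Integrable fun y => y * p y)
    {x : ℝ} (hx : m ≤ x) :
    ∫ y in Set.Ioi x, (y - x) * p y ≤ ∫ y in Set.Ioi x, (y - m) * p y := by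
  refine integral_mono (integrable_sub_mul hp hp1 x).integrableOn
    (integrable_sub_mul hp hp1 m).integrableOn fun y => ?_
  exact mul_le_mul_of_nonneg_right (by linarith) (hp0 y)

theorem tail_nonneg (hp0 : ∀ y, 0 ≤ p y) {x : ℝ} (hx : m ≤ x) :
    0 ≤ ∫ y in Set.Ioi x, (y - m) * p y :=
  setIntegral_nonneg measurableSet_Ioi fun y hy =>
    mul_nonneg (by linarith [Set.mem_Ioi.1 hy]) (hp0 y)

/-- If `g` grows at least linearly at the endpoint, so does the Stein kernel, and the bound is
immediate. -/
theorem exists_mul_tail_le_of_le_deriv (hp0 : ∀ y, 0 ≤ p y) (hp : Integrable p)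
    (hp1 : Integrable fun y => y * p y) (hm : m < x₀) (hc : 0 < c)
    (hg : ∀ x, x₀ ≤ x → (x : EReal) < u → DifferentiableAt ℝ g x) (hg0 : 0 < g x₀)
    (ha : ∀ x, x₀ ≤ x → (x : EReal) < u → c * g x ≤ a x) {ε : ℝ} (hε : 0 < ε)
    (hε' : ∀ x, x₀ ≤ x → (x : EReal) < u → ε ≤ deriv g x) :
    ∃ C : ℝ, ∀ x, x₀ ≤ x → (x : EReal) < u → (x - m) * ∫ y in Set.Ioi x, (y - x) * p y ≤
      C * (a x * ∫ y in Set.Ioi x, (y - m) * p y) := by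
  have hw : 0 < x₀ - m := sub_pos.2 hm
  -- With this `η`, `g` starts above the line `η (x - m)` at `x₀` and grows at least as fast.
  set η := min ε (g x₀ / (x₀ - m)) with hη
  have hη0 : 0 < η := lt_min hε (div_pos hg0 hw)
  refine ⟨1 / (c * η), fun x hx hxu => ?_⟩
  have hIcc : ∀ y ∈ Set.Icc x₀ x, (y : EReal) < u := fun y hy =>
    (EReal.coe_le_coe_iff.2 hy.2).trans_lt hxu
  have h1 : ε * (x - x₀) ≤ g x - g x₀ := by
    refine (convex_Icc x₀ x).mul_sub_le_image_sub_of_le_deriv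
      (fun y hy => (hg y hy.1 (hIcc y hy)).continuousAt.continuousWithinAt)
      (fun y hy => ?_) (fun y hy => ?_) x₀ (Set.left_mem_Icc.2 hx) x (Set.right_mem_Icc.2 hx) hx
    · have := interior_subset hy
      exact (hg y this.1 (hIcc y this)).differentiableWithinAt
    · have := interior_subset hy
      exact hε' y this.1 (hIcc y this)
  have h2 : η * (x₀ - m) ≤ g x₀ := by
    rw [← le_div_iff₀ hw]; exact min_le_right _ _
  have h3 : η * (x - x₀) ≤ ε * (x - x₀) :=
    mul_le_mul_of_nonneg_right (min_le_left _ _) (by linarith)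
  have h4 : η * (x - m) ≤ g x := by nlinarith
  have h5 : c * η * (x - m) ≤ a x := by
    rw [mul_assoc]; exact (mul_le_mul_of_nonneg_left h4 hc.le).trans (ha x hx hxu)
  have h6 := tail_sub_le hp0 hp hp1 (hm.le.trans hx)
  have h7 := tail_nonneg hp0 (hm.le.trans hx)
  rw [one_div, le_inv_mul_iff₀ (by positivity), ← mul_assoc]
  exact mul_le_mul h5 h6 (setIntegral_nonneg measurableSet_Ioi fun y hy =>
    mul_nonneg (by linarith [Set.mem_Ioi.1 hy]) (hp0 y))
    ((mul_nonneg (by positivity) (by linarith)).trans h5)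

/-- With `w = x - m` and `S(x) = ∫ₓ^∞ (y - x) p`, the function `F = g D / w² - κ S / w` is
nonincreasing near `u`. Indeed `(S / w)' = -D / w²` and `D' = -w p`, so `F' = w⁻² (g' D + κ D - g p
w) - 2 g D / w³`. Here `g' ≤ κ`, and `D = a p ≤ C g p` with `κ = (x₀ - m) / (2C)` gives `2κD ≤ g p
w`. As `F` is bounded below by a quantity tending to `0` at `u`, it is nonnegative, and `F ≥ 0` is
the claim up to constants. -/
theorem exists_mul_tail_le_of_deriv_le (hp0 : ∀ y, 0 ≤ p y) (hp : Integrable p)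
    (hp1 : Integrable fun y => y * p y) (hpu : ∀ x : ℝ, u ≤ x → p x = 0)
    (hm : m < x₀)
    (hc : 0 < c) (hC : 0 < C)
    (hg : ∀ x, x₀ ≤ x → (x : EReal) < u → ContDiffAt ℝ 1 g x)
    (hg0 : ∀ x, x₀ ≤ x → (x : EReal) < u → 0 < g x)
    (hap : ∀ x, x₀ ≤ x → (x : EReal) < u → a x * p x = ∫ y in Set.Ioi x, (y - m) * p y)
    (ha : ∀ x, x₀ ≤ x → (x : EReal) < u → c * g x ≤ a x ∧ a x ≤ C * g x)
    (hκ : ∀ x, x₀ ≤ x → (x : EReal) < u → deriv g x ≤ (x₀ - m) / (2 * C)) :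
    ∃ C' : ℝ, ∀ x, x₀ ≤ x → (x : EReal) < u → (x - m) * ∫ y in Set.Ioi x, (y - x) * p y ≤
      C' * (a x * ∫ y in Set.Ioi x, (y - m) * p y) := by
  set D := fun x => ∫ y in Set.Ioi x, (y - m) * p y with hD
  set Q := fun x => ∫ y in Set.Ioi x, p y with hQ
  set S := fun x => D x - (x - m) * Q x with hS
  have hSeq : ∀ x, ∫ y in Set.Ioi x, (y - x) * p y = S x := by
    intro x
    simp only [hS, hD, hQ]
    rw [← integral_const_mul, ← integral_sub (integrable_sub_mul hp hp1 m).integrableOn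
      (hp.const_mul _).integrableOn]
    congr 1; ext y; ring
  set κ := (x₀ - m) / (2 * C) with hκdef
  have hw0 : 0 < x₀ - m := sub_pos.2 hm
  have hκ0 : 0 < κ := by positivity
  set F := fun x => g x * ((x - m)⁻¹ ^ 2) * D x - κ * (S x * (x - m)⁻¹) with hF
  have hanti : ∀ x y : ℝ, x₀ ≤ x → x ≤ y → (y : EReal) < u → F y ≤ F x := by
    intro x y hx hxy hyu
    have hmem : ∀ t ∈ Set.Icc x y, x₀ ≤ t ∧ (t : EReal) < u := fun t ht =>
      ⟨hx.trans ht.1, (EReal.coe_le_coe_iff.2 ht.2).trans_lt hyu⟩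
    have acD : AbsolutelyContinuousOnInterval D x y :=
      absolutelyContinuousOnInterval_tail (integrable_sub_mul hp hp1 m) x y
    have acQ : AbsolutelyContinuousOnInterval Q x y := absolutelyContinuousOnInterval_tail hp x y
    have acg : AbsolutelyContinuousOnInterval g x y := by
      refine ContDiffOn.absolutelyContinuousOnInterval fun t ht => ?_
      rw [Set.uIcc_of_le hxy] at ht
      exact (hg t (hmem t ht).1 (hmem t ht).2).contDiffWithinAt
    have acw : AbsolutelyContinuousOnInterval (fun t => t - m) x y :=
      (contDiff_id.sub contDiff_const).contDiffOn.absolutelyContinuousOnInterval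
    have aci : AbsolutelyContinuousOnInterval (fun t => (t - m)⁻¹) x y := by
      refine absolutelyContinuousOnInterval_inv acw hw0 fun t ht => ?_
      rw [Set.uIcc_of_le hxy] at ht
      linarith [(hmem t ht).1]
    have acF : AbsolutelyContinuousOnInterval F x y := by
      have h1 := (acg.fun_mul (aci.fun_mul aci)).fun_mul acD
      have h2 := ((acD.fun_sub (acw.fun_mul acQ)).fun_mul aci).const_mul κ
      refine (congrArg (fun F => AbsolutelyContinuousOnInterval F x y) (funext fun t => ?_)).mp
        (h1.fun_sub h2)
      simp only [hF, hS]; ring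
    refine le_of_deriv_nonpos acF hxy (f' := fun t =>
      (deriv g t * ((t - m)⁻¹ ^ 2) + g t * (-2 * (t - m)⁻¹ ^ 3)) * D t +
      g t * ((t - m)⁻¹ ^ 2) * (-((t - m) * p t)) +
      κ * (D t * (t - m)⁻¹ ^ 2)) ?_
    filter_upwards [ae_hasDerivAt_tail (integrable_sub_mul hp hp1 m), ae_hasDerivAt_tail hp]
      with t hDt hQt ht
    obtain ⟨ht0, htu⟩ := hmem t ht
    have hw : 0 < t - m := by linarith
    have hDt' : HasDerivAt D (-((t - m) * p t)) t := hDt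
    have hQt' : HasDerivAt Q (-p t) t := hQt
    have hgt := ((hg t ht0 htu).differentiableAt (by simp)).hasDerivAt
    have hwt : HasDerivAt (fun t => t - m) 1 t := (hasDerivAt_id t).sub_const m
    have hit := hwt.inv hw.ne'
    constructor
    · have h1 := (hgt.mul (hit.pow 2)).mul hDt'
      have h2 := ((hDt'.sub (hwt.mul hQt')).mul hit).const_mul κ
      convert! h1.sub h2 using 1
      have hne := hw.ne'
      simp only [Pi.mul_apply, Pi.pow_apply, Pi.inv_apply, Pi.sub_apply, Nat.add_one_sub_one,
        pow_one, Nat.cast_ofNat]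
      field_simp
      ring
    · have hD0 : 0 ≤ D t := tail_nonneg hp0 (by linarith)
      have h1 : D t ≤ C * (g t * p t) := by
        have h := hap t ht0 htu
        have h' := mul_le_mul_of_nonneg_right (ha t ht0 htu).2 (hp0 t)
        rw [h] at h'
        linarith
      have h2 := hκ t ht0 htu
      have h3 : (t - m) * D t ≤ C * (g t * p t) * (t - m) := by nlinarith
      have h4 : 2 * C * κ = x₀ - m := by rw [hκdef]; field_simp
      have h5 : κ * D t + κ * D t ≤ g t * p t * (t - m) := by
        have : C * (κ * D t + κ * D t) ≤ C * (g t * p t * (t - m)) := by nlinarith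
        exact le_of_mul_le_mul_left this hC
      have h6 : deriv g t * D t ≤ κ * D t := mul_le_mul_of_nonneg_right h2 hD0
      have h7 := hg0 t ht0 htu
      have e : (deriv g t * ((t - m)⁻¹ ^ 2) + g t * (-2 * (t - m)⁻¹ ^ 3)) * D t +
          g t * ((t - m)⁻¹ ^ 2) * (-((t - m) * p t)) + κ * (D t * (t - m)⁻¹ ^ 2) =
          (t - m)⁻¹ ^ 2 * (deriv g t * D t + κ * D t - g t * p t * (t - m)) -
          2 * g t * (t - m)⁻¹ ^ 3 * D t := by ring
      rw [e]
      have h8 : 0 ≤ 2 * g t * (t - m)⁻¹ ^ 3 * D t := by positivity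
      have h9 : (t - m)⁻¹ ^ 2 * (deriv g t * D t + κ * D t - g t * p t * (t - m)) ≤ 0 :=
        mul_nonpos_of_nonneg_of_nonpos (by positivity) (by linarith)
      linarith
  have hFnonneg : ∀ x, x₀ ≤ x → (x : EReal) < u → 0 ≤ F x := by
    intro x hx hxu
    have hne := toRight_neBot hxu
    -- From `S ≤ D` and `w ≥ x₀ - m`, `F ≥ -κ D / (x₀ - m)`, and `D → 0` at `u`.
    have hlim : Tendsto (fun y => -(κ * (D y * (x₀ - m)⁻¹))) (toRight u) (𝓝 0) := by
      have : Tendsto D (toRight u) (𝓝 0) := tendsto_tail_toRight (integrable_sub_mul hp hp1 m)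
        fun y hy => by rw [hpu y hy, mul_zero]
      simpa using ((this.mul_const (x₀ - m)⁻¹).const_mul κ).neg
    refine le_of_tendsto hlim ?_
    filter_upwards [eventually_toRight hxu] with y hy
    refine le_trans ?_ (hanti x y hx hy.1.le hy.2)
    have hy0 : x₀ ≤ y := hx.trans hy.1.le
    have hw : 0 < y - m := by linarith
    have hD0 : 0 ≤ D y := tail_nonneg hp0 (by linarith)
    have hg' := hg0 y hy0 hy.2
    have hSD : S y ≤ D y := by
      rw [← hSeq]; exact tail_sub_le hp0 hp hp1 (by linarith)
    have h1 : S y * (y - m)⁻¹ ≤ D y * (x₀ - m)⁻¹ :=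
      mul_le_mul hSD (inv_anti₀ hw0 (by linarith)) (by positivity) hD0
    have h2 : 0 ≤ g y * ((y - m)⁻¹ ^ 2) * D y := by positivity
    have h3 := mul_le_mul_of_nonneg_left h1 hκ0.le
    simp only [hF]
    linarith
  refine ⟨1 / (κ * c), fun x hx hxu => ?_⟩
  rw [hSeq]
  have hw : 0 < x - m := by linarith
  have h := hFnonneg x hx hxu
  simp only [hF] at h
  have hD0 : 0 ≤ D x := tail_nonneg hp0 (by linarith)
  have h1 : κ * (x - m) * S x ≤ g x * D x := by
    have := mul_le_mul_of_nonneg_left h (sq_nonneg (x - m))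
    have e : (x - m) ^ 2 * (g x * (x - m)⁻¹ ^ 2 * D x - κ * (S x * (x - m)⁻¹)) =
      g x * D x - κ * (x - m) * S x := by field_simp
    rw [e] at this
    linarith
  have h2 : c * (g x * D x) ≤ a x * D x := by
    rw [← mul_assoc]; exact mul_le_mul_of_nonneg_right (ha x hx hxu).1 hD0
  rw [one_div, le_inv_mul_iff₀ (by positivity)]
  nlinarith

end Endpoint

/-! ### The Stein kernel of the target law and centred Lipschitz functions. -/

/-- The function `x ↦ ∫ₓ^∞ (y - m) p(y) dy`. -/
noncomputable def meanTail (p : ℝ → ℝ) (x : ℝ) : ℝ := ∫ y in Set.Ioi x, (y - mean p) * p y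

/-- The Stein kernel of the law with density `p`. -/
noncomputable def steinKernel (p : ℝ → ℝ) (x : ℝ) : ℝ := meanTail p x / p x

theorem isOpen_interval (l u : EReal) : IsOpen (interval l u) :=
  isOpen_Ioo.preimage continuous_coe_real_ereal

theorem Icc_subset_interval {l u : EReal} {x y : ℝ} (hx : x ∈ interval l u)
    (hy : y ∈ interval l u) : Set.Icc x y ⊆ interval l u := fun _ ht =>
  ⟨hx.1.trans_le (EReal.coe_le_coe_iff.2 ht.1), (EReal.coe_le_coe_iff.2 ht.2).trans_lt hy.2⟩

theorem neg_mem_interval {l u : EReal} {x : ℝ} : -x ∈ interval l u ↔ x ∈ interval (-u) (-l) := by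
  simp only [interval, Set.mem_ofPred_eq, EReal.coe_neg]
  rw [EReal.lt_neg_comm, EReal.neg_lt_comm, and_comm]

theorem volume_interval_pos {l u : EReal} (h : l < u) : 0 < volume (interval l u) := by
  obtain ⟨x, h1, h2⟩ := EReal.lt_iff_exists_real_btwn.1 h
  exact (isOpen_interval l u).measure_pos volume ⟨x, h1, h2⟩

namespace IsTargetDensity

variable {p : ℝ → ℝ} {l u : EReal} (hp : IsTargetDensity p l u)

include hp

theorem nonneg (x : ℝ) : 0 ≤ p x := by
  by_cases h : x ∈ interval l u
  · exact (hp.pos x h).le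
  · rw [hp.zero x h]

theorem integrable : Integrable p := by
  refine ⟨hp.measurable.aestronglyMeasurable, ?_⟩
  rw [hasFiniteIntegral_iff_ofReal (Eventually.of_forall hp.nonneg), hp.lintegral_eq_one]
  exact ENNReal.one_lt_top

theorem integral_eq_one : ∫ x, p x = 1 := by
  rw [integral_eq_lintegral_of_nonneg_ae (Eventually.of_forall hp.nonneg)
    hp.measurable.aestronglyMeasurable, hp.lintegral_eq_one, ENNReal.toReal_one]

theorem integrable_sub_mean_mul (c : ℝ) : Integrable fun y => (y - c) * p y :=
  integrable_sub_mul hp.integrable hp.first_moment c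

theorem integral_sub_mean : ∫ y, (y - mean p) * p y = 0 := by
  simp only [sub_mul]
  rw [integral_sub hp.first_moment (hp.integrable.const_mul _), integral_const_mul,
    hp.integral_eq_one, mul_one, mean, sub_self]

theorem meanTail_eq_neg (x : ℝ) : meanTail p x = -∫ y in Set.Iic x, (y - mean p) * p y := by
  have h := integral_add_compl (measurableSet_Iic (a := x)) (hp.integrable_sub_mean_mul (mean p))
  rw [hp.integral_sub_mean, Set.compl_Iic] at h
  rw [meanTail]; linarith

/-- The total integral of `(y - m) p` is `0`, so upper and lower tails are opposite. As `θ` is only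
a factor, all later estimates, stated for the kernel, are free of it. -/
theorem sigmaSq_eq (θ x : ℝ) : sigmaSq p θ x = 2 * θ * steinKernel p x := by
  rw [sigmaSq, steinKernel, hp.meanTail_eq_neg]; ring

omit hp in
theorem mean_reflect : mean (fun x => p (-x)) = -mean p := by
  rw [mean, mean, ← integral_neg_eq_self, ← integral_neg]
  simp

/-- Reflection exchanges the endpoints, so estimates are needed only at the right one. -/
theorem reflect : IsTargetDensity (fun x => p (-x)) (-u) (-l) where
  lt := EReal.neg_lt_neg_iff.2 hp.lt
  measurable := hp.measurable.comp measurable_neg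
  pos x hx := hp.pos _ (neg_mem_interval.2 hx)
  zero x hx := hp.zero _ fun h => hx (neg_mem_interval.1 h)
  locally_bounded x hx := by
    obtain ⟨C, hC⟩ := hp.locally_bounded _ (neg_mem_interval.2 hx)
    exact ⟨C, (continuous_neg.tendsto x).eventually hC⟩
  lintegral_eq_one := by
    rw [← hp.lintegral_eq_one]
    exact (Measure.measurePreserving_neg volume).lintegral_comp
      (f := fun x => ENNReal.ofReal (p x)) (hp.measurable.ennreal_ofReal)
  first_moment := by
    have := hp.first_moment.comp_neg.neg
    refine this.congr (Eventually.of_forall fun x => ?_)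
    simp

theorem meanTail_reflect (x : ℝ) : meanTail (fun x => p (-x)) x = meanTail p (-x) := by
  rw [hp.meanTail_eq_neg, meanTail, mean_reflect, ← integral_neg, ← integral_comp_neg_Ioi]
  congr 1; ext y; ring

theorem steinKernel_reflect (x : ℝ) : steinKernel (fun x => p (-x)) x = steinKernel p (-x) := by
  rw [steinKernel, steinKernel, hp.meanTail_reflect]

theorem mean_lt : (mean p : EReal) < u := by
  induction u with
  | bot => exact absurd hp.lt not_lt_bot
  | top => exact EReal.coe_lt_top _
  | coe r =>
    rw [EReal.coe_lt_coe_iff]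
    have h0 : ∀ y, 0 ≤ (r - y) * p y := by
      intro y
      by_cases h : y ∈ interval l r
      · exact mul_nonneg (sub_nonneg.2 (EReal.coe_lt_coe_iff.1 h.2).le) (hp.nonneg y)
      · rw [hp.zero y h, mul_zero]
    have hi : Integrable fun y => (r - y) * p y := by
      refine (hp.integrable_sub_mean_mul r).neg.congr (Eventually.of_forall fun y => ?_)
      simp only [Pi.neg_apply]; ring
    have h1 : 0 < ∫ y, (r - y) * p y := by
      rw [integral_pos_iff_support_of_nonneg h0 hi]
      refine (volume_interval_pos hp.lt).trans_le (measure_mono fun y hy => ?_)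
      exact (mul_pos (sub_pos.2 (EReal.coe_lt_coe_iff.1 hy.2)) (hp.pos y hy)).ne'
    simp only [sub_mul] at h1
    rw [integral_sub (hp.integrable.const_mul _) hp.first_moment, integral_const_mul,
      hp.integral_eq_one] at h1
    rw [mean]; linarith

theorem lt_mean : l < mean p := by
  have := hp.reflect.mean_lt
  rw [mean_reflect, EReal.coe_neg] at this
  exact EReal.neg_lt_neg_iff.1 this

theorem mean_mem : mean p ∈ interval l u := ⟨hp.lt_mean, hp.mean_lt⟩

theorem meanTail_pos_of_ge {x : ℝ} (hx : mean p ≤ x) (hxu : (x : EReal) < u) :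
    0 < meanTail p x := by
  rw [meanTail, setIntegral_pos_iff_support_of_nonneg_ae]
  · refine (volume_interval_pos hxu).trans_le (measure_mono fun y hy => ?_)
    have hxy : x < y := EReal.coe_lt_coe_iff.1 hy.1
    refine ⟨(mul_pos (by linarith) (hp.pos y ⟨?_, hy.2⟩)).ne', hxy⟩
    exact hp.lt_mean.trans (EReal.coe_lt_coe_iff.2 (hx.trans_lt hxy))
  · refine (ae_restrict_iff' measurableSet_Ioi).2 (Eventually.of_forall fun y hy => ?_)
    exact mul_nonneg (by linarith [Set.mem_Ioi.1 hy]) (hp.nonneg y)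
  · exact (hp.integrable_sub_mean_mul _).integrableOn

theorem meanTail_pos {x : ℝ} (hx : x ∈ interval l u) : 0 < meanTail p x := by
  rcases le_total (mean p) x with h | h
  · exact hp.meanTail_pos_of_ge h hx.2
  · have := hp.reflect.meanTail_pos_of_ge (x := -x) (by rw [mean_reflect]; linarith)
      (by rw [EReal.coe_neg]; exact EReal.neg_lt_neg_iff.2 hx.1)
    rwa [hp.meanTail_reflect, neg_neg] at this

theorem steinKernel_pos {x : ℝ} (hx : x ∈ interval l u) : 0 < steinKernel p x :=
  div_pos (hp.meanTail_pos hx) (hp.pos x hx)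

theorem continuous_meanTail : Continuous (meanTail p) :=
  continuous_tail (hp.integrable_sub_mean_mul _)

/-- An upper bound for `p` is what bounds the Stein kernel below on compact subsets of `(l, u)`. -/
theorem exists_le_of_isCompact {s : Set ℝ} (hs : IsCompact s) (hsub : s ⊆ interval l u) :
    ∃ C, 0 < C ∧ ∀ x ∈ s, p x ≤ C := by
  refine hs.induction_on (p := fun s => ∃ C, 0 < C ∧ ∀ x ∈ s, p x ≤ C) ⟨1, one_pos, by simp⟩
    (fun s t hst ⟨C, hC, h⟩ => ⟨C, hC, fun x hx => h x (hst hx)⟩)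
    (fun s t ⟨C, hC, h⟩ ⟨C', hC', h'⟩ => ⟨max C C', lt_max_of_lt_left hC, fun x hx => ?_⟩)
    (fun x hx => ?_)
  · rcases hx with hx | hx
    · exact (h x hx).trans (le_max_left _ _)
    · exact (h' x hx).trans (le_max_right _ _)
  · obtain ⟨C, hC⟩ := hp.locally_bounded x (hsub hx)
    exact ⟨_, mem_nhdsWithin_of_mem_nhds hC, max C 1, lt_max_of_lt_right one_pos,
      fun y hy => le_trans hy (le_max_left _ _)⟩

/-! ### Lipschitz test functions -/

theorem integrable_abs_sub_mul (c : ℝ) : Integrable fun y => |y - c| * p y := by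
  refine (hp.integrable_sub_mean_mul c).abs.congr (Eventually.of_forall fun y => ?_)
  simp only [abs_mul, abs_of_nonneg (hp.nonneg y)]

variable {b : ℝ → ℝ} {K : ℝ} (hb : ∀ x y, |b x - b y| ≤ K * |x - y|)

include hb

theorem integrable_lipschitz_mul : Integrable fun y => b y * p y := by
  have hc : Continuous b := by
    refine LipschitzWith.continuous (K := K.toNNReal) (LipschitzWith.of_dist_le_mul fun x y => ?_)
    rw [Real.dist_eq, Real.dist_eq]
    exact (hb x y).trans (mul_le_mul_of_nonneg_right (Real.le_coe_toNNReal K) (abs_nonneg _))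
  refine (((hp.integrable_abs_sub_mul 0).const_mul K).add (hp.integrable.const_mul |b 0|)).mono'
    (hc.measurable.mul hp.measurable).aestronglyMeasurable (Eventually.of_forall fun y => ?_)
  have h1 : |b y| ≤ K * |y - 0| + |b 0| := by
    have := hb y 0
    have h2 := abs_sub_abs_le_abs_sub (b y) (b 0)
    linarith
  rw [norm_mul, Real.norm_eq_abs, Real.norm_eq_abs, abs_of_nonneg (hp.nonneg y)]
  refine (mul_le_mul_of_nonneg_right h1 (hp.nonneg y)).trans_eq ?_
  simp only [Pi.add_apply]
  ring

/-- Since `b` is centred, `b(x) = ∫ (b(x) - b(y)) p(y) dy`. -/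
theorem abs_le_of_centered (hb0 : ∫ y, b y * p y = 0) (x : ℝ) :
    |b x| ≤ K * (|x - mean p| + ∫ y, |y - mean p| * p y) := by
  have hK : 0 ≤ K := by
    have := (abs_nonneg _).trans (hb 1 0)
    simpa using this
  have h1 : b x = ∫ y, (b x - b y) * p y := by
    simp only [sub_mul]
    rw [integral_sub (hp.integrable.const_mul _) (hp.integrable_lipschitz_mul hb), hb0,
      integral_const_mul, hp.integral_eq_one]
    ring
  have hi := ((hp.integrable.const_mul |x - mean p|).add
    (hp.integrable_abs_sub_mul (mean p))).const_mul K
  rw [h1]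
  refine (norm_integral_le_of_norm_le (f := fun y => (b x - b y) * p y) hi
    (Eventually.of_forall fun y => ?_)).trans_eq ?_
  · rw [norm_mul, Real.norm_eq_abs, Real.norm_eq_abs, abs_of_nonneg (hp.nonneg y)]
    have h2 : |x - y| ≤ |x - mean p| + |y - mean p| := by
      have := abs_sub_le x (mean p) y
      rwa [abs_sub_comm (mean p) y] at this
    have h3 := (hb x y).trans (mul_le_mul_of_nonneg_left h2 hK)
    refine (mul_le_mul_of_nonneg_right h3 (hp.nonneg y)).trans_eq ?_
    simp only [Pi.add_apply]; ring
  · simp only [Pi.add_apply]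
    rw [integral_const_mul, integral_add (hp.integrable.const_mul _)
      (hp.integrable_abs_sub_mul (mean p)), integral_const_mul, hp.integral_eq_one, mul_one]

omit hb in
-- Chebyshev's association inequality: `g` and the indicator of `(x, ∞)` are both nondecreasing,
-- hence nonnegatively correlated. The proof compares `g` with `g(x)` on either side of `x`.
theorem tail_mul_integral_le {g : ℝ → ℝ} (hg : Monotone g) (hi : Integrable fun y => g y * p y)
    (x : ℝ) : (∫ y in Set.Ioi x, p y) * ∫ y, g y * p y ≤ ∫ y in Set.Ioi x, g y * p y := by
  have h1 := integral_add_compl (measurableSet_Iic (a := x)) hi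
  have h2 := integral_add_compl (measurableSet_Iic (a := x)) hp.integrable
  rw [Set.compl_Iic] at h1 h2
  rw [hp.integral_eq_one] at h2
  have h3 : g x * ∫ y in Set.Ioi x, p y ≤ ∫ y in Set.Ioi x, g y * p y := by
    rw [← integral_const_mul]
    exact setIntegral_mono_on (hp.integrable.const_mul _).integrableOn hi.integrableOn
      measurableSet_Ioi fun y hy => mul_le_mul_of_nonneg_right (hg (le_of_lt hy)) (hp.nonneg y)
  have h4 : ∫ y in Set.Iic x, g y * p y ≤ g x * ∫ y in Set.Iic x, p y := by
    rw [← integral_const_mul]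
    exact setIntegral_mono_on hi.integrableOn (hp.integrable.const_mul _).integrableOn
      measurableSet_Iic fun y hy => mul_le_mul_of_nonneg_right (hg hy) (hp.nonneg y)
  have h5 : 0 ≤ ∫ y in Set.Ioi x, p y := integral_nonneg hp.nonneg
  have h6 : 0 ≤ ∫ y in Set.Iic x, p y := integral_nonneg hp.nonneg
  have h7 := mul_le_mul_of_nonneg_left h3 h6
  have h8 := mul_le_mul_of_nonneg_left h4 h5
  rw [← h1]
  generalize ∫ y in Set.Iic x, p y = q at *
  generalize ∫ y in Set.Ioi x, p y = q' at *
  generalize ∫ y in Set.Ioi x, g y * p y = A at *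
  generalize ∫ y in Set.Iic x, g y * p y = A' at *
  obtain rfl : q = 1 - q' := by linarith
  nlinarith

/-- The functions `K (y - m) ± b(y)` are nondecreasing with integral `0` against `p`, so their upper
tails are nonnegative by association. -/
theorem abs_tail_le (hb0 : ∫ y, b y * p y = 0) (x : ℝ) :
    |∫ y in Set.Ioi x, b y * p y| ≤ K * meanTail p x := by
  have hbi := hp.integrable_lipschitz_mul hb
  have hK : ∀ s : ℝ, |s| = 1 → 0 ≤ K * meanTail p x + s * ∫ y in Set.Ioi x, b y * p y := by
    intro s hs
    have hmono : Monotone fun y => K * (y - mean p) + s * b y := by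
      intro y z hyz
      have h1 := (le_abs_self _).trans_eq (abs_mul s (b y - b z))
      rw [hs, one_mul] at h1
      have h2 := hb y z
      rw [abs_sub_comm y z, abs_of_nonneg (sub_nonneg.2 hyz)] at h2
      simp only
      linarith
    have e : (fun y => (K * (y - mean p) + s * b y) * p y) =
        fun y => K * ((y - mean p) * p y) + s * (b y * p y) := by ext y; ring
    have hi1 := (hp.integrable_sub_mean_mul (mean p)).const_mul K
    have hi2 := hbi.const_mul s
    have h := hp.tail_mul_integral_le hmono (by rw [e]; exact hi1.add hi2) x
    rw [e, integral_add hi1 hi2, integral_const_mul, integral_const_mul, hp.integral_sub_mean, hb0,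
      integral_add hi1.integrableOn hi2.integrableOn, integral_const_mul, integral_const_mul] at h
    rw [meanTail]
    linarith
  rw [abs_le]
  constructor
  · linarith [hK 1 (by simp)]
  · linarith [hK (-1) (by simp)]

/-- The expression vanishes at `z = y`: it equals `(b(z) - b(y))(y - m) - b(y)(z - y)`. The linear
bound on `b(y)` becomes a multiple of `y - m` because `y` stays at distance at least `x₁ - m` from
the mean. -/
theorem abs_cross_le (hb0 : ∫ y, b y * p y = 0) {x₁ y z : ℝ} (hx₁ : mean p < x₁) (hy : x₁ ≤ y) :
    |b z * (y - mean p) - b y * (z - mean p)| ≤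
      K * (2 + (∫ t, |t - mean p| * p t) / (x₁ - mean p)) * (y - mean p) * |z - y| := by
  have hK : 0 ≤ K := by
    have := (abs_nonneg _).trans (hb 1 0)
    simpa using this
  set B := ∫ t, |t - mean p| * p t with hB
  have hB0 : 0 ≤ B := integral_nonneg fun t => mul_nonneg (abs_nonneg _) (hp.nonneg t)
  have hw : 0 < x₁ - mean p := sub_pos.2 hx₁
  have hwy : 0 < y - mean p := by linarith
  have h1 := hp.abs_le_of_centered hb hb0 y
  rw [abs_of_pos hwy, ← hB] at h1
  have h2 : B ≤ B / (x₁ - mean p) * (y - mean p) := by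
    rw [div_mul_eq_mul_div, le_div_iff₀ hw]
    exact mul_le_mul_of_nonneg_left (by linarith) hB0
  have h3 : |b y| ≤ K * (1 + B / (x₁ - mean p)) * (y - mean p) := by
    refine h1.trans ?_
    rw [mul_assoc]
    exact mul_le_mul_of_nonneg_left (by linarith) hK
  have e : b z * (y - mean p) - b y * (z - mean p) =
      (b z - b y) * (y - mean p) - b y * (z - y) := by ring
  rw [e]
  refine (abs_sub _ _).trans ?_
  rw [abs_mul, abs_mul, abs_of_pos hwy]
  have h4 := mul_le_mul_of_nonneg_right (hb z y) hwy.le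
  have h5 := mul_le_mul_of_nonneg_right h3 (abs_nonneg (z - y))
  linarith

end IsTargetDensity

/-! ### The Stein equation to the right of the mean. -/

/-- At the right endpoint, the Stein kernel is comparable to a positive `C¹` function whose
derivative has a limit. -/
def RightEndCondition (p : ℝ → ℝ) (l u : EReal) : Prop :=
  ∃ (g : ℝ → ℝ) (c C : ℝ), 0 < c ∧ 0 < C ∧ ContDiffOn ℝ 1 g (interval l u) ∧
    (∀ x ∈ interval l u, 0 < g x) ∧
    (∀ᶠ x in toRight u, c * g x ≤ steinKernel p x ∧ steinKernel p x ≤ C * g x) ∧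
    ∃ L : EReal, Tendsto (fun x => ((deriv g x : ℝ) : EReal)) (toRight u) (𝓝 L)

open Classical in
/-- The solution of the Stein equation with right-hand side `b`. -/
noncomputable def steinSol (p : ℝ → ℝ) (l u : EReal) (b : ℝ → ℝ) (x : ℝ) : ℝ :=
  if x ∈ interval l u then -(∫ y in Set.Ioi x, b y * p y) / meanTail p x
  else -b x / (x - mean p)

open Classical in
/-- A version of the derivative of the solution of the Stein equation. -/
noncomputable def steinDeriv (p : ℝ → ℝ) (l u : EReal) (b : ℝ → ℝ) (x : ℝ) : ℝ :=
  if x ∈ interval l u then (b x + (x - mean p) * steinSol p l u b x) / steinKernel p x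
  else deriv (steinSol p l u b) x

namespace IsTargetDensity

variable {p : ℝ → ℝ} {l u : EReal} (hp : IsTargetDensity p l u)

include hp

theorem zero_of_le {x : ℝ} (hx : u ≤ x) : p x = 0 := hp.zero x fun h => hx.not_gt h.2

theorem mem_of_mean_le {x : ℝ} (hx : mean p ≤ x) (hxu : (x : EReal) < u) : x ∈ interval l u :=
  ⟨hp.lt_mean.trans_le (EReal.coe_le_coe_iff.2 hx), hxu⟩

/-- The limit of `g'` at `u` is either positive, and then `g` dominates a multiple of `x - m`, or at
most `0`, and then `g'` is eventually below any positive threshold. -/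
theorem exists_mul_tail_le (he : RightEndCondition p l u) :
    ∃ x₁ : ℝ, mean p < x₁ ∧ (x₁ : EReal) < u ∧ ∃ C : ℝ, ∀ x, x₁ ≤ x → (x : EReal) < u →
      (x - mean p) * ∫ y in Set.Ioi x, (y - x) * p y ≤ C * (steinKernel p x * meanTail p x) := by
  obtain ⟨g, c, C, hc, hC, hg, hg0, hgk, L, hL⟩ := he
  have hgd : ∀ x, mean p ≤ x → (x : EReal) < u → ContDiffAt ℝ 1 g x := fun x hx hxu =>
    hg.contDiffAt ((isOpen_interval l u).mem_nhds (hp.mem_of_mean_le hx hxu))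
  obtain ⟨x₀, hm, hu, hk⟩ := exists_real_of_eventually_toRight hp.mean_lt hgk
  rcases lt_or_ge 0 L with h0 | h0
  · obtain ⟨ε, hε, hεL⟩ := EReal.lt_iff_exists_real_btwn.1 h0
    obtain ⟨x₁, hx₁, hu₁, h⟩ := exists_real_of_eventually_toRight hu
      (hL.eventually (lt_mem_nhds hεL))
    have hmx : mean p < x₁ := hm.trans hx₁
    refine ⟨x₁, hmx, hu₁, exists_mul_tail_le_of_le_deriv (g := g) (u := u) hp.nonneg hp.integrable
      hp.first_moment hmx hc (fun x hx hxu => ?_) (hg0 _ (hp.mem_of_mean_le hmx.le hu₁))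
      (fun x hx hxu => (hk x (hx₁.le.trans hx) hxu).1) (EReal.coe_pos.1 hε)
      fun x hx hxu => (EReal.coe_lt_coe_iff.1 (h x hx hxu)).le⟩
    exact (hgd x (hmx.le.trans hx) hxu).differentiableAt (by simp)
  -- The threshold is computed at `x₀`; replacing the base point by `x₁ > x₀` only enlarges it.
  · have hκ : 0 < (x₀ - mean p) / (2 * C) := div_pos (sub_pos.2 hm) (by positivity)
    obtain ⟨x₁, hx₁, hu₁, h⟩ := exists_real_of_eventually_toRight hu
      (hL.eventually (gt_mem_nhds (h0.trans_lt (EReal.coe_pos.2 hκ))))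
    have hmx : mean p < x₁ := hm.trans hx₁
    refine ⟨x₁, hmx, hu₁, exists_mul_tail_le_of_deriv_le (g := g) hp.nonneg hp.integrable
      hp.first_moment (fun x hx => hp.zero_of_le hx) hmx hc hC
      (fun x hx hxu => hgd x (hmx.le.trans hx) hxu)
      (fun x hx hxu => hg0 _ (hp.mem_of_mean_le (hmx.le.trans hx) hxu)) (fun x hx hxu => ?_)
      (fun x hx hxu => hk x (hx₁.le.trans hx) hxu) fun x hx hxu => ?_⟩
    · exact div_mul_cancel₀ _ (hp.pos x (hp.mem_of_mean_le (hmx.le.trans hx) hxu)).ne'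
    · refine (EReal.coe_lt_coe_iff.1 (h x hx hxu)).le.trans ?_
      gcongr

section

variable {b : ℝ → ℝ} {K : ℝ}

theorem abs_steinSol_le (hb : ∀ x y, |b x - b y| ≤ K * |x - y|) (hb0 : ∫ y, b y * p y = 0)
    {x : ℝ} (hx : x ∈ interval l u) : |steinSol p l u b x| ≤ K := by
  rw [steinSol, if_pos hx, abs_div, abs_neg, abs_of_pos (hp.meanTail_pos hx),
    div_le_iff₀ (hp.meanTail_pos hx)]
  exact hp.abs_tail_le hb hb0 x

theorem abs_add_mul_steinSol_le (hb : ∀ x y, |b x - b y| ≤ K * |x - y|)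
    (hb0 : ∫ y, b y * p y = 0) {x : ℝ} (hx : x ∈ interval l u) :
    |b x + (x - mean p) * steinSol p l u b x| ≤
      K * (2 * |x - mean p| + ∫ y, |y - mean p| * p y) := by
  have h1 := hp.abs_le_of_centered hb hb0 x
  have h2 := mul_le_mul_of_nonneg_left (hp.abs_steinSol_le hb hb0 hx) (abs_nonneg (x - mean p))
  refine (abs_add_le _ _).trans ?_
  rw [abs_mul]
  linarith

end

/-- Between `m` and `x₁` the kernel is bounded below and the crude linear bound suffices. Beyond
`x₁` the numerator times `D` is an integral with a cancelling integrand, bounded by a multiple of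
`(x - m) ∫ₓ^∞ (y - x) p`. -/
theorem exists_stein_factor_right (he : RightEndCondition p l u) : ∃ C : ℝ, 0 ≤ C ∧
    ∀ (K : ℝ) (b : ℝ → ℝ), (∀ x y, |b x - b y| ≤ K * |x - y|) → ∫ y, b y * p y = 0 →
    ∀ x ∈ interval l u, mean p ≤ x →
      |b x + (x - mean p) * steinSol p l u b x| ≤ K * C * steinKernel p x := by
  obtain ⟨x₁, hx₁, hu₁, C', hC'⟩ := hp.exists_mul_tail_le he
  set B := ∫ t, |t - mean p| * p t with hB
  have hB0 : 0 ≤ B := integral_nonneg fun t => mul_nonneg (abs_nonneg _) (hp.nonneg t)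
  have hw₁ : 0 < x₁ - mean p := sub_pos.2 hx₁
  have hsub : Set.Icc (mean p) x₁ ⊆ interval l u :=
    Icc_subset_interval hp.mean_mem (hp.mem_of_mean_le hx₁.le hu₁)
  obtain ⟨P, hP0, hP⟩ := hp.exists_le_of_isCompact isCompact_Icc hsub
  obtain ⟨x₂, hx₂, hmin⟩ := isCompact_Icc.exists_isMinOn (Set.nonempty_Icc.2 hx₁.le)
    hp.continuous_meanTail.continuousOn
  have hδ : 0 < meanTail p x₂ := hp.meanTail_pos (hsub hx₂)
  set C₁ := (2 * (x₁ - mean p) + B) * (P / meanTail p x₂) with hC₁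
  set C₂ := (2 + B / (x₁ - mean p)) * C' with hC₂
  refine ⟨max C₁ C₂, le_max_of_le_left (by positivity), fun K b hb hb0 x hx hmx => ?_⟩
  have hK : 0 ≤ K := by
    have := (abs_nonneg _).trans (hb 1 0)
    simpa using this
  have hk := hp.steinKernel_pos hx
  have hD := hp.meanTail_pos hx
  rcases le_total x x₁ with h | h
  · have hk' : meanTail p x₂ / P ≤ steinKernel p x := by
      rw [steinKernel]
      exact div_le_div₀ hD.le (hmin ⟨hmx, h⟩) (hp.pos x hx) (hP x ⟨hmx, h⟩)
    have h1 : 2 * |x - mean p| + B ≤ C₁ * steinKernel p x := by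
      have h2 : 1 ≤ P / meanTail p x₂ * steinKernel p x := by
        have := mul_le_mul_of_nonneg_left hk' (div_pos hP0 hδ).le
        have e : P / meanTail p x₂ * (meanTail p x₂ / P) = 1 := by field_simp
        linarith
      have h3 := mul_le_mul_of_nonneg_left h2 (show 0 ≤ 2 * (x₁ - mean p) + B by positivity)
      rw [abs_of_nonneg (sub_nonneg.2 hmx), hC₁]
      nlinarith
    refine (hp.abs_add_mul_steinSol_le hb hb0 hx).trans ?_
    rw [mul_assoc]
    refine mul_le_mul_of_nonneg_left (h1.trans ?_) hK
    exact mul_le_mul_of_nonneg_right (le_max_left _ _) hk.le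
  · have hi1 := (hp.integrable_sub_mean_mul (mean p)).const_mul (b x)
    have hi2 := (hp.integrable_lipschitz_mul hb).const_mul (x - mean p)
    have e : (b x + (x - mean p) * steinSol p l u b x) * meanTail p x =
        ∫ y in Set.Ioi x, (b x * ((y - mean p) * p y) - (x - mean p) * (b y * p y)) := by
      rw [integral_sub hi1.integrableOn hi2.integrableOn, integral_const_mul, integral_const_mul,
        steinSol, if_pos hx]
      have : (∫ y in Set.Ioi x, (y - mean p) * p y) = meanTail p x := rfl
      rw [this]
      field_simp
      ring
    have h1 : |∫ y in Set.Ioi x, (b x * ((y - mean p) * p y) - (x - mean p) * (b y * p y))| ≤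
        ∫ y in Set.Ioi x, K * (2 + B / (x₁ - mean p)) * (x - mean p) * ((y - x) * p y) := by
      refine norm_integral_le_of_norm_le
        (f := fun y => b x * ((y - mean p) * p y) - (x - mean p) * (b y * p y))
        (((hp.integrable_sub_mean_mul x).const_mul _).integrableOn)
        ((ae_restrict_iff' measurableSet_Ioi).2 (Eventually.of_forall fun y hy => ?_))
      have h2 := hp.abs_cross_le hb hb0 (z := y) hx₁ h
      rw [abs_of_pos (sub_pos.2 (Set.mem_Ioi.1 hy)), abs_sub_comm] at h2
      have e' : b x * ((y - mean p) * p y) - (x - mean p) * (b y * p y) =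
        (b x * (y - mean p) - b y * (x - mean p)) * p y := by ring
      rw [e', norm_mul, Real.norm_eq_abs, Real.norm_eq_abs, abs_of_nonneg (hp.nonneg y),
        ← mul_assoc]
      exact mul_le_mul_of_nonneg_right h2 (hp.nonneg y)
    rw [integral_const_mul, ← e, abs_mul, abs_of_pos hD] at h1
    have h2 := mul_le_mul_of_nonneg_left (hC' x h hx.2)
      (show 0 ≤ K * (2 + B / (x₁ - mean p)) by positivity)
    have h3 : |b x + (x - mean p) * steinSol p l u b x| * meanTail p x ≤
        K * C₂ * steinKernel p x * meanTail p x := by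
      rw [hC₂]; linarith
    refine (le_of_mul_le_mul_right h3 hD).trans ?_
    exact mul_le_mul_of_nonneg_right (mul_le_mul_of_nonneg_left (le_max_right _ _) hK) hk.le

section

variable {b : ℝ → ℝ} {K : ℝ} (hb : ∀ x y, |b x - b y| ≤ K * |x - y|)

include hb

/-- The quotient rule at points where both tails are differentiable, with `p / D = 1 / a`. -/
theorem ae_hasDerivAt_steinSol : ∀ᵐ t, t ∈ interval l u →
    HasDerivAt (fun t => -(∫ y in Set.Ioi t, b y * p y) * (meanTail p t)⁻¹)
      (steinDeriv p l u b t) t := by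
  filter_upwards [ae_hasDerivAt_tail (hp.integrable_sub_mean_mul (mean p)),
    ae_hasDerivAt_tail (hp.integrable_lipschitz_mul hb)] with t h1 h2 ht
  have hD := hp.meanTail_pos ht
  have hpt := hp.pos t ht
  have h1' : HasDerivAt (meanTail p) (-((t - mean p) * p t)) t := h1
  convert! h2.neg.mul (h1'.inv hD.ne') using 1
  rw [steinDeriv, if_pos ht, steinSol, if_pos ht, steinKernel]
  simp only [Pi.neg_apply, Pi.inv_apply]
  field_simp

theorem ae_deriv_steinSol : ∀ᵐ t, deriv (steinSol p l u b) t = steinDeriv p l u b t := by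
  filter_upwards [hp.ae_hasDerivAt_steinSol hb] with t ht
  by_cases hm : t ∈ interval l u
  · refine HasDerivAt.deriv ((ht hm).congr_of_eventuallyEq ?_)
    filter_upwards [(isOpen_interval l u).mem_nhds hm] with s hs
    rw [steinSol, if_pos hs, div_eq_mul_inv]
  · rw [steinDeriv, if_neg hm]

theorem abs_steinSol_sub_le_of_mem {x z M : ℝ} (hx : x ∈ interval l u) (hz : z ∈ interval l u)
    (hxz : x ≤ z) (hM : ∀ t ∈ Set.Icc x z, |steinDeriv p l u b t| ≤ M) :
    |steinSol p l u b x - steinSol p l u b z| ≤ M * (z - x) := by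
  have hsub := Icc_subset_interval hx hz
  obtain ⟨x₂, hx₂, hmin⟩ := isCompact_Icc.exists_isMinOn (Set.nonempty_Icc.2 hxz)
    hp.continuous_meanTail.continuousOn
  have acD : AbsolutelyContinuousOnInterval (meanTail p) x z :=
    absolutelyContinuousOnInterval_tail (hp.integrable_sub_mean_mul (mean p)) x z
  have acN := (absolutelyContinuousOnInterval_tail (hp.integrable_lipschitz_mul hb) x z).fun_neg
  have acF := acN.fun_mul (absolutelyContinuousOnInterval_inv acD (hp.meanTail_pos (hsub hx₂))
    fun t ht => hmin (by rwa [Set.uIcc_of_le hxz] at ht))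
  have h := abs_sub_le_of_abs_deriv_le acF (C := M) (by
    filter_upwards [hp.ae_hasDerivAt_steinSol hb] with t ht ht'
    rw [Set.uIcc_of_le hxz] at ht'
    rw [(ht (hsub ht')).deriv]
    exact hM t ht')
  rw [abs_of_nonneg (sub_nonneg.2 hxz), abs_sub_comm] at h
  rw [steinSol, steinSol, if_pos hx, if_pos hz, div_eq_mul_inv, div_eq_mul_inv]
  exact h

/-- For `x` inside and `z` beyond `u`, `(f(x) - f(z)) (z - m) D(x)` is the integral over `(x, ∞)` of
`(b(z)(y - m) - b(y)(z - m)) p(y)`, where only `y < u ≤ z` contributes and `z - y ≤ z - x`. With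
both points outside, the same cross term appears without an integral. So `f` has no jump at a finite
`u`. -/
theorem abs_steinSol_sub_le_of_notMem (hb0 : ∫ y, b y * p y = 0) {x₁ x z : ℝ}
    (hx₁ : mean p < x₁) (hx : x₁ ≤ x) (hxz : x ≤ z) (hz : z ∉ interval l u) :
    |steinSol p l u b x - steinSol p l u b z| ≤
      K * ((2 + (∫ t, |t - mean p| * p t) / (x₁ - mean p)) / (x₁ - mean p)) * (z - x) := by
  have hK : 0 ≤ K := by
    have := (abs_nonneg _).trans (hb 1 0)
    simpa using this
  set B := ∫ t, |t - mean p| * p t with hB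
  have hB0 : 0 ≤ B := integral_nonneg fun t => mul_nonneg (abs_nonneg _) (hp.nonneg t)
  have hw₁ : 0 < x₁ - mean p := sub_pos.2 hx₁
  have hwx : 0 < x - mean p := by linarith
  have hwz : 0 < z - mean p := by linarith
  have hzx : 0 ≤ z - x := by linarith
  have hfin : K * (2 + B / (x₁ - mean p)) * (z - x) / (z - mean p) ≤
      K * ((2 + B / (x₁ - mean p)) / (x₁ - mean p)) * (z - x) := by
    rw [div_le_iff₀ hwz]
    have e : K * ((2 + B / (x₁ - mean p)) / (x₁ - mean p)) * (z - x) * (z - mean p) =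
      K * (2 + B / (x₁ - mean p)) * (z - x) * ((z - mean p) / (x₁ - mean p)) := by ring
    rw [e]
    refine le_mul_of_one_le_right (by positivity) ?_
    rw [one_le_div hw₁]; linarith
  have hzu : u ≤ z := by
    by_contra h
    exact hz (hp.mem_of_mean_le (by linarith) (not_le.1 h))
  refine le_trans ?_ hfin
  rw [le_div_iff₀ hwz, ← abs_of_pos hwz, ← abs_mul]
  have hsz : steinSol p l u b z = -b z / (z - mean p) := by rw [steinSol, if_neg hz]
  by_cases hxm : x ∈ interval l u
  · have hD := hp.meanTail_pos hxm
    have hi1 := (hp.integrable_sub_mean_mul (mean p)).const_mul (b z)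
    have hi2 := (hp.integrable_lipschitz_mul hb).const_mul (z - mean p)
    have e : (steinSol p l u b x - steinSol p l u b z) * (z - mean p) * meanTail p x =
        ∫ y in Set.Ioi x, (b z * ((y - mean p) * p y) - (z - mean p) * (b y * p y)) := by
      rw [integral_sub hi1.integrableOn hi2.integrableOn, integral_const_mul, integral_const_mul,
        hsz, steinSol, if_pos hxm]
      have : (∫ y in Set.Ioi x, (y - mean p) * p y) = meanTail p x := rfl
      rw [this]
      field_simp
      ring
    have h1 : |∫ y in Set.Ioi x, (b z * ((y - mean p) * p y) - (z - mean p) * (b y * p y))| ≤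
        ∫ y in Set.Ioi x, K * (2 + B / (x₁ - mean p)) * (z - x) * ((y - mean p) * p y) := by
      refine norm_integral_le_of_norm_le
        (f := fun y => b z * ((y - mean p) * p y) - (z - mean p) * (b y * p y))
        (((hp.integrable_sub_mean_mul (mean p)).const_mul _).integrableOn)
        ((ae_restrict_iff' measurableSet_Ioi).2 (Eventually.of_forall fun y hy => ?_))
      have hy' : x < y := hy
      have e' : b z * ((y - mean p) * p y) - (z - mean p) * (b y * p y) =
        (b z * (y - mean p) - b y * (z - mean p)) * p y := by ring
      rw [e', norm_mul, Real.norm_eq_abs, Real.norm_eq_abs, abs_of_nonneg (hp.nonneg y),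
        ← mul_assoc]
      rcases lt_or_ge (y : EReal) u with hyu | hyu
      · have hyz : y < z := EReal.coe_lt_coe_iff.1 (hyu.trans_le hzu)
        have h2 := hp.abs_cross_le hb hb0 (z := z) hx₁ (hx.trans hy'.le)
        rw [abs_of_pos (sub_pos.2 hyz), ← hB] at h2
        refine mul_le_mul_of_nonneg_right (h2.trans ?_) (hp.nonneg y)
        rw [mul_right_comm]
        have hwy : 0 ≤ y - mean p := by linarith
        gcongr
      · rw [hp.zero_of_le hyu]; simp
    rw [integral_const_mul, ← e, abs_mul, abs_of_pos hD] at h1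
    exact le_of_mul_le_mul_right h1 hD
  · have h2 := hp.abs_cross_le hb hb0 (z := z) hx₁ hx
    rw [abs_of_nonneg hzx, ← hB] at h2
    have hsx : steinSol p l u b x = -b x / (x - mean p) := by rw [steinSol, if_neg hxm]
    have e : (steinSol p l u b x - steinSol p l u b z) * (z - mean p) * (x - mean p) =
        b z * (x - mean p) - b x * (z - mean p) := by
      rw [hsx, hsz]; field_simp; ring
    rw [← e, abs_mul, abs_of_pos hwx, mul_right_comm] at h2
    exact le_of_mul_le_mul_right h2 hwx

end

/-- The bound reaching outside `(l, u)` degenerates at the mean, so increments are chained through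
an interior point `x₁ > m`. -/
theorem exists_steinSol_bounds_right (he : RightEndCondition p l u) : ∃ C : ℝ, 0 ≤ C ∧
    ∀ (K : ℝ) (b : ℝ → ℝ), (∀ x y, |b x - b y| ≤ K * |x - y|) → ∫ y, b y * p y = 0 →
    (∀ x ∈ interval l u, mean p ≤ x → |steinDeriv p l u b x| ≤ K * C) ∧
    ∀ x z, mean p ≤ x → x ≤ z → |steinSol p l u b x - steinSol p l u b z| ≤ K * C * (z - x) := by
  obtain ⟨C₁, hC₁, H⟩ := hp.exists_stein_factor_right he
  obtain ⟨x₁, hx₁, hu₁⟩ := EReal.lt_iff_exists_real_btwn.1 hp.mean_lt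
  rw [EReal.coe_lt_coe_iff] at hx₁
  have hx₁m := hp.mem_of_mean_le hx₁.le hu₁
  set C₂ := (2 + (∫ t, |t - mean p| * p t) / (x₁ - mean p)) / (x₁ - mean p) with hC₂
  refine ⟨max C₁ C₂, le_max_of_le_left hC₁, fun K b hb hb0 => ?_⟩
  have hK : 0 ≤ K := by
    have := (abs_nonneg _).trans (hb 1 0)
    simpa using this
  have hd : ∀ x ∈ interval l u, mean p ≤ x → |steinDeriv p l u b x| ≤ K * max C₁ C₂ := by
    intro x hx hmx
    have hk := hp.steinKernel_pos hx
    rw [steinDeriv, if_pos hx, abs_div, abs_of_pos hk, div_le_iff₀ hk]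
    refine (H K b hb hb0 x hx hmx).trans ?_
    have := le_max_left C₁ C₂
    gcongr
  have hin : ∀ x z, x ∈ interval l u → z ∈ interval l u → mean p ≤ x → x ≤ z →
      |steinSol p l u b x - steinSol p l u b z| ≤ K * max C₁ C₂ * (z - x) := by
    intro x z hx hz hmx hxz
    exact hp.abs_steinSol_sub_le_of_mem hb hx hz hxz fun t ht =>
      hd t (Icc_subset_interval hx hz ht) (hmx.trans ht.1)
  have hout : ∀ x z, x₁ ≤ x → x ≤ z → z ∉ interval l u →
      |steinSol p l u b x - steinSol p l u b z| ≤ K * max C₁ C₂ * (z - x) := by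
    intro x z hx hxz hz
    refine (hp.abs_steinSol_sub_le_of_notMem hb hb0 hx₁ hx hxz hz).trans ?_
    have := le_max_right C₁ C₂
    rw [← hC₂]
    have : 0 ≤ z - x := by linarith
    gcongr
  refine ⟨hd, fun x z hmx hxz => ?_⟩
  by_cases hz : z ∈ interval l u
  · have hx : x ∈ interval l u :=
      hp.mem_of_mean_le hmx ((EReal.coe_le_coe_iff.2 hxz).trans_lt hz.2)
    exact hin x z hx hz hmx hxz
  · rcases le_total x₁ x with h | h
    · exact hout x z h hxz hz
    · have hx : x ∈ interval l u :=
        hp.mem_of_mean_le hmx ((EReal.coe_le_coe_iff.2 h).trans_lt hu₁)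
      have hz₁ : x₁ ≤ z := by
        by_contra hcon
        exact hz (hp.mem_of_mean_le (hmx.trans hxz)
          ((EReal.coe_lt_coe_iff.2 (not_le.1 hcon)).trans hu₁))
      have h1 := hin x x₁ hx hx₁m hmx h
      have h2 := hout x₁ z le_rfl hz₁ hz
      have h3 := abs_sub_le (steinSol p l u b x) (steinSol p l u b x₁) (steinSol p l u b z)
      linarith

end IsTargetDensity

/-! ### The left endpoint by reflection, and the global solution. -/

theorem tendsto_neg_toRight (l : EReal) : Tendsto (fun x : ℝ => -x) (toRight (-l)) (toLeft l) := by
  rw [toLeft, tendsto_comap_iff]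
  have h1 : Tendsto (fun y : EReal => -y) (𝓝[<] (-l)) (𝓝[>] l) := by
    refine tendsto_nhdsWithin_iff.2 ⟨?_, ?_⟩
    · have := ((continuous_neg (G := EReal)).tendsto (-l)).mono_left
        (nhdsWithin_le_nhds (s := Set.Iio (-l)))
      rwa [neg_neg] at this
    · filter_upwards [self_mem_nhdsWithin] with y hy
      exact EReal.lt_neg_comm.1 hy
  refine (h1.comp (tendsto_comap (f := fun x : ℝ => (x : EReal)))).congr fun x => ?_
  simp

theorem eventually_mul_le_of_liminf {s k g : ℝ → ℝ} {F : Filter ℝ} {θ : ℝ} (hθ : 0 < θ)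
    (hs : ∀ x, s x = 2 * θ * k x) (hg : ∀ᶠ x in F, 0 < g x)
    (h1 : 0 < liminf (fun x => ((s x / g x : ℝ) : EReal)) F)
    (h2 : limsup (fun x => ((s x / g x : ℝ) : EReal)) F < ⊤) :
    ∃ c C : ℝ, 0 < c ∧ 0 < C ∧ ∀ᶠ x in F, c * g x ≤ k x ∧ k x ≤ C * g x := by
  obtain ⟨c, hc, hc'⟩ := EReal.lt_iff_exists_real_btwn.1 h1
  obtain ⟨C, hC, -⟩ := EReal.lt_iff_exists_real_btwn.1 h2
  -- The maximum with `1` makes the upper constant positive.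
  refine ⟨c / (2 * θ), max C 1 / (2 * θ), div_pos (EReal.coe_pos.1 hc) (by positivity),
    by positivity, ?_⟩
  filter_upwards [hg, eventually_lt_of_lt_liminf hc', eventually_lt_of_limsup_lt hC]
    with x hx hx1 hx2
  rw [EReal.coe_lt_coe_iff, hs] at hx1 hx2
  rw [lt_div_iff₀ hx] at hx1
  rw [div_lt_iff₀ hx] at hx2
  rw [div_mul_eq_mul_div, div_mul_eq_mul_div, div_le_iff₀ (by positivity),
    le_div_iff₀ (by positivity)]
  have := mul_le_mul_of_nonneg_right (le_max_left C 1) hx.le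
  constructor <;> linarith

namespace IsTargetDensity

variable {p : ℝ → ℝ} {l u : EReal} (hp : IsTargetDensity p l u)

include hp

theorem rightEndCondition {θ : ℝ} (hθ : 0 < θ) (h : SteinFactorCondition (sigmaSq p θ) l u) :
    RightEndCondition p l u := by
  obtain ⟨g, hg, hg0, h1, h2, hL, -⟩ := h.comparison
  have hgu : ∀ᶠ x in toRight u, 0 < g x := by
    filter_upwards [eventually_toRight hp.mean_lt] with x hx
    exact hg0 x (hp.mem_of_mean_le hx.1.le hx.2)
  obtain ⟨c, C, hc, hC, hk⟩ := eventually_mul_le_of_liminf hθ (hp.sigmaSq_eq θ) hgu h1 h2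
  exact ⟨g, c, C, hc, hC, hg, hg0, hk, hL⟩

theorem rightEndCondition_reflect {θ : ℝ} (hθ : 0 < θ)
    (h : SteinFactorCondition (sigmaSq p θ) l u) :
    RightEndCondition (fun x => p (-x)) (-u) (-l) := by
  obtain ⟨g, hg, hg0, -, -, -, h1, h2, L, hL⟩ := h.comparison
  have hmaps : Set.MapsTo (fun x : ℝ => -x) (interval (-u) (-l)) (interval l u) :=
    fun x hx => neg_mem_interval.2 hx
  have hgl : ∀ᶠ x in toLeft l, 0 < g x := by
    have hlt : l < (mean p : EReal) := hp.lt_mean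
    rw [toLeft, eventually_comap]
    filter_upwards [Ioo_mem_nhdsGT hlt] with y hy x hx
    subst hx
    exact hg0 x ⟨hy.1, hy.2.trans hp.mean_lt⟩
  obtain ⟨c, C, hc, hC, hk⟩ := eventually_mul_le_of_liminf hθ (hp.sigmaSq_eq θ) hgl h1 h2
  -- The derivative of `g(-x)` changes sign, so its limit is `-L`.
  refine ⟨fun x => g (-x), c, C, hc, hC, hg.comp contDiff_neg.contDiffOn hmaps,
    fun x hx => hg0 _ (hmaps hx), ?_, -L, ?_⟩
  · filter_upwards [(tendsto_neg_toRight l).eventually hk] with x hx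
    rwa [hp.steinKernel_reflect]
  · have := ((continuous_neg (G := EReal)).tendsto L).comp (hL.comp (tendsto_neg_toRight l))
    refine this.congr fun x => ?_
    rw [deriv_comp_neg]
    simp

section

variable {b : ℝ → ℝ} {K : ℝ} (hb : ∀ x y, |b x - b y| ≤ K * |x - y|) (hb0 : ∫ y, b y * p y = 0)

include hb hb0

/-- Reflection turns upper tails into lower ones, which differ by a sign because `b` is centred. -/
theorem steinSol_reflect (x : ℝ) :
    steinSol (fun x => p (-x)) (-u) (-l) (fun x => b (-x)) x = -steinSol p l u b (-x) := by
  by_cases h : -x ∈ interval l u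
  · rw [steinSol, steinSol, if_pos h, if_pos (neg_mem_interval.1 h), hp.meanTail_reflect]
    have h1 := integral_comp_neg_Ioi x (fun y => b y * p y)
    have h2 := integral_add_compl (measurableSet_Iic (a := -x)) (hp.integrable_lipschitz_mul hb)
    rw [hb0, Set.compl_Iic] at h2
    rw [h1, neg_div]
    congr 2
    linarith
  · rw [steinSol, steinSol, if_neg h, if_neg fun h' => h (neg_mem_interval.2 h'), mean_reflect,
      show x - -mean p = -(-x - mean p) by ring, div_neg]

theorem steinDeriv_reflect {x : ℝ} (h : -x ∈ interval l u) :
    steinDeriv (fun x => p (-x)) (-u) (-l) (fun x => b (-x)) x = steinDeriv p l u b (-x) := by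
  rw [steinDeriv, steinDeriv, if_pos h, if_pos (neg_mem_interval.1 h), hp.steinKernel_reflect,
    hp.steinSol_reflect hb hb0, mean_reflect]
  congr 1
  ring

end

/-- The two one-sided estimates are glued at the mean, which lies in `(l, u)`. -/
theorem exists_steinSol_bounds (hr : RightEndCondition p l u)
    (hl : RightEndCondition (fun x => p (-x)) (-u) (-l)) : ∃ C : ℝ, 0 ≤ C ∧
    ∀ (K : ℝ) (b : ℝ → ℝ), (∀ x y, |b x - b y| ≤ K * |x - y|) → ∫ y, b y * p y = 0 →
    (∀ x ∈ interval l u, |steinDeriv p l u b x| ≤ K * C) ∧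
    ∀ x z, |steinSol p l u b x - steinSol p l u b z| ≤ K * C * |x - z| := by
  obtain ⟨C₁, hC₁, h₁⟩ := hp.exists_steinSol_bounds_right hr
  obtain ⟨C₂, hC₂, h₂⟩ := hp.reflect.exists_steinSol_bounds_right hl
  refine ⟨max C₁ C₂, le_max_of_le_left hC₁, fun K b hb hb0 => ?_⟩
  have hK : 0 ≤ K := by
    have := (abs_nonneg _).trans (hb 1 0)
    simpa using this
  have hK₁ : K * C₁ ≤ K * max C₁ C₂ := mul_le_mul_of_nonneg_left (le_max_left _ _) hK
  have hK₂ : K * C₂ ≤ K * max C₁ C₂ := mul_le_mul_of_nonneg_left (le_max_right _ _) hK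
  obtain ⟨hd₁, hf₁⟩ := h₁ K b hb hb0
  obtain ⟨hd₂, hf₂⟩ := h₂ K (fun x => b (-x))
    (fun x y => by
      have := hb (-x) (-y)
      rwa [neg_sub_neg, abs_sub_comm y x] at this)
    (by rw [integral_neg_eq_self (fun y => b y * p y)]; exact hb0)
  have hleft : ∀ x z, x ≤ z → z ≤ mean p →
      |steinSol p l u b x - steinSol p l u b z| ≤ K * max C₁ C₂ * (z - x) := by
    intro x z hxz hz
    have := hf₂ (-z) (-x) (by rw [mean_reflect]; linarith) (by linarith)
    rw [hp.steinSol_reflect hb hb0, hp.steinSol_reflect hb hb0, neg_neg, neg_neg,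
      neg_sub_neg] at this
    refine this.trans ?_
    rw [neg_sub_neg]
    exact mul_le_mul_of_nonneg_right hK₂ (by linarith)
  have hright : ∀ x z, x ≤ z → mean p ≤ x →
      |steinSol p l u b x - steinSol p l u b z| ≤ K * max C₁ C₂ * (z - x) := fun x z hxz hx =>
    (hf₁ x z hx hxz).trans (mul_le_mul_of_nonneg_right hK₁ (by linarith))
  have hle : ∀ x z, x ≤ z →
      |steinSol p l u b x - steinSol p l u b z| ≤ K * max C₁ C₂ * (z - x) := by
    intro x z hxz
    rcases le_total (mean p) x with h | h
    · exact hright x z hxz h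
    · rcases le_total z (mean p) with h' | h'
      · exact hleft x z hxz h'
      · have h3 := abs_sub_le (steinSol p l u b x) (steinSol p l u b (mean p)) (steinSol p l u b z)
        have h4 := hleft x (mean p) h le_rfl
        have h5 := hright (mean p) z h' le_rfl
        linarith
  refine ⟨fun x hx => ?_, fun x z => ?_⟩
  · rcases le_total (mean p) x with h | h
    · exact (hd₁ x hx h).trans hK₁
    · have hx' : -(-x) ∈ interval l u := by rwa [neg_neg]
      have := hd₂ (-x) (neg_mem_interval.1 hx') (by rw [mean_reflect]; linarith)
      rw [hp.steinDeriv_reflect hb hb0 hx', neg_neg] at this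
      exact this.trans hK₂
  · rcases le_total x z with h | h
    · rw [abs_sub_comm x z, abs_of_nonneg (sub_nonneg.2 h)]
      exact hle x z h
    · rw [abs_sub_comm, abs_of_nonneg (sub_nonneg.2 h)]
      exact hle z x h

/-- The Stein equation has a solution `f` which is the primitive of a function `φ` bounded in terms
of the Lipschitz constant of the right-hand side, and the equation holds at every point. -/
theorem exists_stein_solution (hr : RightEndCondition p l u)
    (hl : RightEndCondition (fun x => p (-x)) (-u) (-l)) : ∃ C : ℝ, 0 ≤ C ∧
    ∀ (K : ℝ) (b : ℝ → ℝ), (∀ x y, |b x - b y| ≤ K * |x - y|) → ∫ y, b y * p y = 0 →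
    ∃ f φ : ℝ → ℝ, Measurable φ ∧ (∀ x, |φ x| ≤ K * C) ∧
      (∀ x, f x = f 0 + ∫ t in (0 : ℝ)..x, φ t) ∧
      ∀ x, (interval l u).indicator (steinKernel p) x * φ x - (x - mean p) * f x = b x := by
  obtain ⟨C, hC, H⟩ := hp.exists_steinSol_bounds hr hl
  refine ⟨C, hC, fun K b hb hb0 => ?_⟩
  have hK : 0 ≤ K := by
    have := (abs_nonneg _).trans (hb 1 0)
    simpa using this
  obtain ⟨hd, hf⟩ := H K b hb hb0
  have hKC : ((K * C).toNNReal : ℝ) = K * C := Real.coe_toNNReal _ (mul_nonneg hK hC)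
  have hlip : LipschitzWith (K * C).toNNReal (steinSol p l u b) :=
    LipschitzWith.of_dist_le_mul fun x y => by
      rw [hKC, Real.dist_eq, Real.dist_eq]; exact hf x y
  have hblip : LipschitzWith K.toNNReal b := LipschitzWith.of_dist_le_mul fun x y => by
    rw [Real.coe_toNNReal _ hK, Real.dist_eq, Real.dist_eq]; exact hb x y
  refine ⟨steinSol p l u b, steinDeriv p l u b, ?_, fun x => ?_, fun x => ?_, fun x => ?_⟩
  · refine Measurable.ite (isOpen_interval l u).measurableSet ?_ (measurable_deriv _)
    exact (hblip.continuous.measurable.add ((measurable_id.sub_const _).mul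
      hlip.continuous.measurable)).div (hp.continuous_meanTail.measurable.div hp.measurable)
  · by_cases hx : x ∈ interval l u
    · exact hd x hx
    · rw [steinDeriv, if_neg hx, ← hKC]
      exact norm_deriv_le_of_lipschitz hlip
  -- The explicit formula agrees with the derivative only almost everywhere, which is enough for `f`
  -- to be its primitive.
  · have ac : AbsolutelyContinuousOnInterval (steinSol p l u b) 0 x :=
      hlip.lipschitzOnWith.absolutelyContinuousOnInterval
    have h := ac.integral_deriv_eq_sub
    rw [intervalIntegral.integral_congr_ae
      ((hp.ae_deriv_steinSol (u := u) (l := l) hb).mono fun t ht _ => ht)] at h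
    linarith
  · by_cases hx : x ∈ interval l u
    · rw [Set.indicator_of_mem hx, steinDeriv, if_pos hx,
        mul_div_cancel₀ _ (hp.steinKernel_pos hx).ne']
      ring
    -- Off `(l, u)` the kernel term vanishes and `f = -b / (x - m)` solves the equation whatever the
    -- value of `φ`; the mean is not such a point.
    · have hne : x - mean p ≠ 0 := fun h => hx (by rw [sub_eq_zero.1 h]; exact hp.mean_mem)
      rw [Set.indicator_of_notMem hx, steinSol, if_neg hx]
      field_simp
      ring

theorem inv_mul_tau {θ : ℝ} (hθ : 0 < θ) (x : ℝ) :
    θ⁻¹ * tau p l u θ x = (interval l u).indicator (steinKernel p) x := by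
  by_cases hx : x ∈ interval l u
  · rw [tau, Set.indicator_of_mem hx, Set.indicator_of_mem hx, hp.sigmaSq_eq]
    field_simp
  · rw [tau, Set.indicator_of_notMem hx, Set.indicator_of_notMem hx, mul_zero]

theorem integral_law (h : ℝ → ℝ) :
    ∫ x, h x ∂law p = ∫ x, h x * p x := by
  rw [law, integral_withDensity_eq_integral_toReal_smul hp.measurable.ennreal_ofReal
    (Eventually.of_forall fun x => ENNReal.ofReal_lt_top)]
  refine integral_congr_ae (Eventually.of_forall fun x => ?_)
  simp only [ENNReal.toReal_ofReal (hp.nonneg x), smul_eq_mul, mul_comm]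

end IsTargetDensity

/-! ### The Stein bound on the Markov triple. -/

theorem abs_sub_le_of_eLpNorm_deriv_le {h : ℝ → ℝ}
    (hac : ∀ a b : ℝ, AbsolutelyContinuousOnInterval h a b) {S : ℝ≥0∞}
    (hS : eLpNorm (deriv h) ∞ volume ≤ S) (hS' : S ≠ ∞) (x y : ℝ) :
    |h x - h y| ≤ S.toReal * |x - y| := by
  refine abs_sub_le_of_abs_deriv_le (hac y x) ?_
  filter_upwards [ae_le_eLpNormEssSup (f := deriv h) (μ := volume)] with t ht _
  rw [eLpNorm_exponent_top] at hS
  have := (ENNReal.toReal_le_toReal (by simp) hS').2 (ht.trans hS)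
  simpa using this

namespace MarkovTriple

variable {E : Type*} [MeasurableSpace E] {μ : Measure E} [IsProbabilityMeasure μ]
  (M : MarkovTriple E μ) {G : Lp ℝ 2 μ}

theorem ΓExt_neg_LInv (hG : G ∈ M.domE) (hinv : M.InvDefined G) :
    M.ΓExt G (-(M.LInv G)) =ᵐ[μ] fun x => -M.ΓExt (M.LInv G) G x := by
  have hU := (M.isPseudoInv_LInv hinv).1.1
  have e := PreMarkovTriple.ΓExt_smul_right (-1) hG hU
  rw [neg_one_smul, neg_one_smul, PreMarkovTriple.ΓExt_symm hG hU] at e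
  rw [e]
  exact Lp.coeFn_neg _

/-- The Stein identity for a random variable with Stein kernel `Γ(G, -L⁻¹G)`. -/
theorem integral_stein (hG : G ∈ M.domE) (hinv : M.InvDefined G) {m : ℝ}
    (hm : ∫ x, G x ∂μ = m) {φ f : ℝ → ℝ} (hφ : Measurable φ) {C : ℝ} (hC : ∀ t, |φ t| ≤ C)
    (hf : ∀ x, f x = f 0 + ∫ t in (0 : ℝ)..x, φ t) :
    Integrable (fun x => (G x - m) * f (G x)) μ ∧
    ∫ x, (G x - m) * f (G x) ∂μ = ∫ x, φ (G x) * M.ΓExt G (-(M.LInv G)) x ∂μ := by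
  obtain ⟨hU, -, hLU⟩ := M.isPseudoInv_LInv hinv
  have hGi : Integrable G μ := (Lp.memLp G).integrable (by norm_num)
  have hL : M.LExt (M.LInv G) =ᵐ[μ] fun x => G x - m := by
    rw [hLU, center, hm]
    filter_upwards [Lp.coeFn_sub G (Lp.const 2 μ m), Lp.coeFn_const (p := 2) (μ := μ) m]
      with x h1 h2
    rw [h1, Pi.sub_apply, h2]
    rfl
  have hi := integrable_primitive_mul (μ := μ) (Lp.stronglyMeasurable G).measurable
    (Lp.stronglyMeasurable (M.LExt (M.LInv G))).aestronglyMeasurable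
    ((Lp.memLp G).integrable_mul (Lp.memLp (M.LExt (M.LInv G)))) hφ hC
  have hLi : Integrable (M.LExt (M.LInv G)) μ := (Lp.memLp _).integrable (by norm_num)
  -- The primitive starts from `0`, so `f(0)` is split off; it contributes nothing because `G - m`
  -- is centred.
  have e : (fun x => f 0 * M.LExt (M.LInv G) x +
      (∫ t in (0 : ℝ)..G x, φ t) * M.LExt (M.LInv G) x) =ᵐ[μ] fun x => (G x - m) * f (G x) := by
    filter_upwards [hL] with x hx
    rw [hx, hf (G x)]; ring
  refine ⟨((hLi.const_mul (f 0)).add hi).congr e, ?_⟩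
  rw [← integral_congr_ae e, integral_add (hLi.const_mul (f 0)) hi, integral_const_mul,
    integral_congr_ae hL, integral_sub hGi (integrable_const m), hm,
    PreMarkovTriple.integral_primitive_mul_LExt hU hG hφ hC, ← integral_neg]
  simp only [integral_const, probReal_univ, one_smul, sub_self, mul_zero, zero_add]
  refine integral_congr_ae ?_
  filter_upwards [M.ΓExt_neg_LInv hG hinv] with x hx
  rw [hx]; ring

/-- The Stein bound for one Lipschitz test function. -/
theorem abs_integral_le_of_stein_equation (hG : G ∈ M.domE) (hinv : M.InvDefined G) {m : ℝ}
    (hm : ∫ x, G x ∂μ = m) {φ f b a : ℝ → ℝ} (hφ : Measurable φ) {C : ℝ} (hC : ∀ t, |φ t| ≤ C)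
    (hf : ∀ x, f x = f 0 + ∫ t in (0 : ℝ)..x, φ t) (ha : Integrable (fun x => a (G x)) μ)
    (h : ∀ x, a x * φ x - (x - m) * f x = b x) :
    ENNReal.ofReal |∫ x, b (G x) ∂μ| ≤
      ENNReal.ofReal C * ∫⁻ x, ‖M.ΓExt G (-(M.LInv G)) x - a (G x)‖ₑ ∂μ := by
  obtain ⟨hi, hst⟩ := M.integral_stein hG hinv hm hφ hC hf
  have hGm : Measurable G := (Lp.stronglyMeasurable G).measurable
  have hγ : Integrable (M.ΓExt G (-(M.LInv G))) μ := memLp_one_iff_integrable.1 (Lp.memLp _)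
  have ia := integrable_comp_mul hGm ha hφ hC
  have iγ := integrable_comp_mul hGm hγ hφ hC
  have e : ∫ x, b (G x) ∂μ = -∫ x, φ (G x) * (M.ΓExt G (-(M.LInv G)) x - a (G x)) ∂μ := by
    simp_rw [← h, mul_sub]
    rw [integral_sub iγ ia, integral_sub (ia.congr (Eventually.of_forall fun x => mul_comm _ _)) hi,
      hst]
    simp_rw [mul_comm (a _)]
    ring
  have hW := hγ.sub ha
  have hb : |∫ x, b (G x) ∂μ| ≤ C * ∫ x, ‖M.ΓExt G (-(M.LInv G)) x - a (G x)‖ ∂μ := by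
    rw [e, abs_neg, ← integral_const_mul]
    refine norm_integral_le_of_norm_le (f := fun x =>
      φ (G x) * (M.ΓExt G (-(M.LInv G)) x - a (G x))) (hW.norm.const_mul C)
      (Eventually.of_forall fun x => ?_)
    rw [norm_mul]
    exact mul_le_mul_of_nonneg_right (hC _) (norm_nonneg _)
  refine (ENNReal.ofReal_le_ofReal hb).trans_eq ?_
  rw [ENNReal.ofReal_mul ((abs_nonneg _).trans (hC 0))]
  congr 1
  exact ofReal_integral_norm_eq_lintegral_enorm hW

end MarkovTriple

end CarreDuChamp

open CarreDuChamp in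
theorem theorem3p2
    -- the target law `ν`, with density `p` supported by `(l, u)`
    (p : ℝ → ℝ) (l u : EReal) (hp : IsTargetDensity p l u)
    -- the class of test functions
    (H : Set (ℝ → ℝ)) (hH_meas : ∀ h ∈ H, Measurable h) (hH_sep : Separating H)
    (hH_ac : ∀ h ∈ H, ∀ a b : ℝ, AbsolutelyContinuousOnInterval h a b)
    (hH_deriv : (⨆ h ∈ H, eLpNorm (deriv h) ∞ volume) < ∞) :
    ∃ c : ℝ, 0 < c ∧
      ∀ θ : ℝ, 0 < θ → SteinFactorCondition (sigmaSq p θ) l u →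
      ∀ (E : Type*) [MeasurableSpace E] (μ : Measure E) [IsProbabilityMeasure μ]
        (M : MarkovTriple E μ) (G : Lp ℝ 2 μ),
        G ∈ M.domL → M.InvDefined G →
        Integrable (fun x => tau p l u θ (G x)) μ →
        ∫ x, G x ∂μ = mean p →
      ∀ (Ω : Type*) [MeasurableSpace Ω] (P : Measure Ω) [IsProbabilityMeasure P] (Z : Ω → ℝ),
        AEMeasurable Z P → P.map Z = law p →
        Admissible H G μ Z P →
        probDist H G μ Z P ≤
          ENNReal.ofReal c *
            ∫⁻ x, ‖M.ΓExt G (-(M.LInv G)) x - θ⁻¹ * tau p l u θ (G x)‖ₑ ∂μ := by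
  -- If no `θ` satisfies the condition, any constant will do. Otherwise one such `θ₀` yields bounds
  -- on the Stein kernel, hence a constant valid for every `θ`.
  by_cases hex : ∃ θ : ℝ, 0 < θ ∧ SteinFactorCondition (sigmaSq p θ) l u
  swap
  · exact ⟨1, one_pos, fun θ hθ h => absurd ⟨θ, hθ, h⟩ hex⟩
  obtain ⟨θ₀, hθ₀, h₀⟩ := hex
  obtain ⟨C, hC, hstein⟩ := hp.exists_stein_solution (hp.rightEndCondition hθ₀ h₀)
    (hp.rightEndCondition_reflect hθ₀ h₀)
  set S := ⨆ h ∈ H, eLpNorm (deriv h) ∞ volume with hS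
  -- `S` times the Stein factor bounds `φ` for every `h` in the class; the added `1` only ensures
  -- positivity.
  refine ⟨S.toReal * C + 1, by positivity, ?_⟩
  intro θ hθ _ E _ μ _ M G hG hinv hτ hm Ω _ P _ Z hZ hlaw hadm
  refine iSup₂_le fun h hh => ?_
  obtain ⟨hhG, -⟩ := hadm h hh
  have hZint : ∫ ω, h (Z ω) ∂P = ∫ y, h y * p y := by
    rw [← hp.integral_law, ← hlaw,
      integral_map hZ (hH_meas h hh).aestronglyMeasurable]
  have hlip := abs_sub_le_of_eLpNorm_deriv_le (hH_ac h hh)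
    (le_iSup₂ (f := fun h (_ : h ∈ H) => eLpNorm (deriv h) ∞ volume) h hh) hH_deriv.ne
  set e := ∫ y, h y * p y with he
  have hb : ∀ x y, |(h x - e) - (h y - e)| ≤ S.toReal * |x - y| := fun x y => by
    rw [sub_sub_sub_cancel_right]; exact hlip x y
  have hb0 : ∫ y, (h y - e) * p y = 0 := by
    simp only [sub_mul]
    rw [integral_sub (hp.integrable_lipschitz_mul hlip) (hp.integrable.const_mul _),
      integral_const_mul, hp.integral_eq_one, mul_one, ← he, sub_self]
  obtain ⟨f, φ, hφ, hφC, hf, heq⟩ := hstein S.toReal (fun x => h x - e) hb hb0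
  have key := M.abs_integral_le_of_stein_equation hG.1 hinv hm (a := fun x => θ⁻¹ * tau p l u θ x)
    hφ hφC hf (hτ.const_mul _) (b := fun x => h x - e) fun x => by
      rw [hp.inv_mul_tau hθ]; exact heq x
  rw [integral_sub hhG (integrable_const e)] at key
  simp only [integral_const, probReal_univ, one_smul] at key
  rw [hZint]
  refine key.trans ?_
  gcongr
  linarith
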